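/- Let $k>0$, $\alpha\in\mathbb R$, and for $j\in\mathbb Z$ put $\alpha_j=\alpha+j$, $\beta_j=\sqrt{k^2-\alpha_j^2}$ if $k^2\ge\alpha_j^2$ and $\beta_j=i\sqrt{\alpha_j^2-k^2}$ otherwise; assume $\beta_j\neq 0$ for all $j$. A function $f$ on $\mathbb R^2$ is called $\alpha$-quasiperiodic if $f(x_1+2\pi j,x_2)=e^{i2\pi j\alpha}f(x_1,x_2)$ for all $j\in\mathbb Z$ and all $x$. Let $n:\mathbb R^2\to\mathbb C$ be bounded, measurable and $2\pi$-periodic in $x_1$, and put $q=n-1$, $\Omega=(-\pi,\pi)\times\mathbb R$, $D=\operatorname{supp}(q)\cap\Omega$. Let $h>0$ satisfy $h>\sup\{|x_2| : x\in D\}$. Let $N,p$ be nonnegative integers. For $l=1,\dots,N$ let $u_{in}(\cdot,l)$ be a locally integrable $\alpha$-quasiperiodic incident field, and let $u_{sc}(\cdot,l)$ be a scattered field generated by it: with $u=u_{in}+u_{sc}$ the total field, $u_{sc}(\cdot,l)$ is locally integrable, $\alpha$-quasiperiodic, satisfies $$\Delta u_{sc}+k^2u_{sc}=-k^2qu\quad\text{in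 }\mathbb R^2$$ in the sense of distributions, and satisfies the Rayleigh expansion condition $$u_{sc}(x,l)=\begin{cases}\sum_{j\in\mathbb Z}u_j^+(l)\,e^{i\alpha_jx_1+i\beta_j(x_2-h)}, & x_2\ge h,\\ \sum_{j\in\mathbb Z}u_j^-(l)\,e^{i\alpha_jx_1-i\beta_j(x_2+h)}, & x_2\le -h,\end{cases}$$ with Rayleigh coefficients $u_j^\pm(l)\in\mathbb C$. Let $$g_j^\pm(z)=\frac{i}{4\pi\beta_j}e^{-i\alpha_jz_1\mp i\beta_j(z_2\mp h)},$$ the Rayleigh coefficients of the $\alpha$-quasiperiodic Green function, and define the indicator function $$I(z)=\sum_{l=1}^N\Big|\sum_{j:\beta_j>0}\beta_j\big(u_j^+(l)\overline{g_j^+(z)}+u_j^-(l)\overline{g_j^-(z)}\big)\Big|^p,\qquad z\in\Omega.$$ Let $J_0$ be the Bessel function of the first kind of order $0$. Then for all $z,y\in\Omega$ the (in general only conditionally convergent) series $$w_\alpha(z,y)=\sum_{j\in\mathbb Z\setminus\{0\}}e^{-i2\pi j\alpha}J_0\Big(k\sqrt{(z_1-y_1+2j\pi)^2+(z_2-y_2)^2}\Big)$$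 converges, in the sense that its partial sums over $-M\le j\le M'$, $j\ne0$, converge as $M,M'\to\infty$ independently; and for every $z\in\Omega$ the integrands below are integrable over $D$ and $$I(z)=\Big(\frac{k^2}{8\pi}\Big)^p\sum_{l=1}^N\Big|\int_D\big[J_0(k|z-y|)+w_\alpha(z,y)\big]q(y)u(y,l)\,dy\Big|^p .$$ -/

import Mathlib

open MeasureTheory
open scoped ContDiff Nat ComplexConjugate Laplacian

noncomputable section

namespace PeriodicScattering

/-- The Euclidean plane, with coordinates `x 0` (horizontal) and `x 1` (vertical). -/
abbrev Plane : Type := EuclideanSpace ℝ (Fin 2)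

/-- The horizontal translate `(x₁ + t, x₂)` of the point `(x₁, x₂)`. -/
def shift (x : Plane) (t : ℝ) : Plane := !₂[x 0 + t, x 1]

/-- `f (x₁ + 2πj, x₂) = e^{i2πjα} f (x₁, x₂)` for all integers `j`. -/
def IsQuasiperiodic (α : ℝ) (f : Plane → ℂ) : Prop :=
  ∀ (j : ℤ) (x : Plane),
    f (shift x (2 * Real.pi * j)) = Complex.exp (Complex.I * (2 * Real.pi * j * α)) * f x

/-- One period cell, `Ω = (-π, π) × ℝ`. -/
def cell : Set Plane := {x | -Real.pi < x 0 ∧ x 0 < Real.pi}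

/-- The contrast `q = n - 1`. -/
def contrast (n : Plane → ℂ) (x : Plane) : ℂ := n x - 1

/-- The scatterer in one period cell, `D = supp q ∩ Ω`. -/
def scatterer (n : Plane → ℂ) : Set Plane := tsupport (contrast n) ∩ cell

/-- `n` is a bounded measurable function, `2π`-periodic in the horizontal direction, and
`h > 0`, `h > sup {|x₂| : x ∈ D}`. -/
structure IsMedium (n : Plane → ℂ) (h : ℝ) : Prop where
  measurable : Measurable n
  bounded : ∃ C : ℝ, ∀ x, ‖n x‖ ≤ C
  periodic : ∀ x, n (shift x (2 * Real.pi)) = n x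
  height_pos : 0 < h
  lt_height : ∃ c < h, ∀ x ∈ scatterer n, |x 1| ≤ c

/-- `α_j = α + j`. -/
def alphaMode (α : ℝ) (j : ℤ) : ℝ := α + j

/-- `β_j = √(k² - α_j²)` if `k² ≥ α_j²`, and `β_j = i √(α_j² - k²)` otherwise. -/
def betaMode (α k : ℝ) (j : ℤ) : ℂ :=
  if alphaMode α j ^ 2 ≤ k ^ 2 then (Real.sqrt (k ^ 2 - alphaMode α j ^ 2) : ℂ)
  else Complex.I * (Real.sqrt (alphaMode α j ^ 2 - k ^ 2) : ℂ)

/-- The indices of the propagating modes: `β_j` is a positive real number. -/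
def propagating (α k : ℝ) : Set ℤ :=
  {j | (betaMode α k j).im = 0 ∧ 0 < (betaMode α k j).re}

theorem propagating_finite (α k : ℝ) : (propagating α k).Finite := by
  refine (Set.finite_Icc ⌊-(|k| + |α|)⌋ ⌈|k| + |α|⌉).subset ?_
  rintro j ⟨-, hj⟩
  have h1 : alphaMode α j ^ 2 ≤ k ^ 2 := by
    by_contra hcon
    simp [betaMode, hcon] at hj
  have h2 : |α + (j : ℝ)| ≤ |k| := sq_le_sq.mp h1
  have h3 := abs_le.mp h2
  have h4 := le_abs_self α
  have h5 := neg_abs_le α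
  constructor
  · have h6 : ((⌊-(|k| + |α|)⌋ : ℤ) : ℝ) ≤ (j : ℝ) :=
      (Int.floor_le _).trans (by linarith)
    exact_mod_cast h6
  · have h6 : (j : ℝ) ≤ ((⌈|k| + |α|⌉ : ℤ) : ℝ) :=
      le_trans (by linarith) (Int.le_ceil _)
    exact_mod_cast h6

/-- `Δ v + k² v = f` in the plane, in the sense of distributions. -/
def IsHelmholtzSolution (k : ℝ) (v f : Plane → ℂ) : Prop :=
  ∀ ψ : Plane → ℂ, ContDiff ℝ ∞ ψ → HasCompactSupport ψ →
    ∫ x, v x * ((Δ ψ) x + (k : ℂ) ^ 2 * ψ x) = ∫ x, f x * ψ x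

/-- The Rayleigh expansion condition for `v`, with Rayleigh sequences `(up j)` and `(um j)`. -/
structure HasRayleighExpansion (α k h : ℝ) (v : Plane → ℂ) (up um : ℤ → ℂ) : Prop where
  above : ∀ x : Plane, h ≤ x 1 →
    HasSum (fun j : ℤ => up j *
      Complex.exp (Complex.I * alphaMode α j * x 0 + Complex.I * betaMode α k j * (x 1 - h))) (v x)
  below : ∀ x : Plane, x 1 ≤ -h →
    HasSum (fun j : ℤ => um j *
      Complex.exp (Complex.I * alphaMode α j * x 0 - Complex.I * betaMode α k j * (x 1 + h))) (v x)

/-- `usc` is a scattered field generated by the incident field `uin`, and `(up j)`, `(um j)` are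
its Rayleigh sequences; the total field is `uin + usc`. -/
structure IsScatteredField (α k h : ℝ) (n uin usc : Plane → ℂ) (up um : ℤ → ℂ) : Prop where
  locallyIntegrable : LocallyIntegrable usc
  quasiperiodic : IsQuasiperiodic α usc
  helmholtz :
    IsHelmholtzSolution k usc (fun x => -(k : ℂ) ^ 2 * contrast n x * (uin x + usc x))
  rayleigh : HasRayleighExpansion α k h usc up um

/-- The Rayleigh coefficient `g_j⁺(z) = i/(4πβ_j) e^{-iα_j z₁ - iβ_j (z₂ - h)}` of the
`α`-quasiperiodic Green function with source at `z`. -/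
def greenCoeffPlus (α k h : ℝ) (j : ℤ) (z : Plane) : ℂ :=
  Complex.I / (4 * Real.pi * betaMode α k j) *
    Complex.exp (-Complex.I * alphaMode α j * z 0 - Complex.I * betaMode α k j * (z 1 - h))

/-- The Rayleigh coefficient `g_j⁻(z) = i/(4πβ_j) e^{-iα_j z₁ + iβ_j (z₂ + h)}` of the
`α`-quasiperiodic Green function with source at `z`. -/
def greenCoeffMinus (α k h : ℝ) (j : ℤ) (z : Plane) : ℂ :=
  Complex.I / (4 * Real.pi * betaMode α k j) *
    Complex.exp (-Complex.I * alphaMode α j * z 0 + Complex.I * betaMode α k j * (z 1 + h))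

/-- The indicator function `I(z)`. -/
def indicator (α k h : ℝ) (p : ℕ) {N : ℕ} (up um : Fin N → ℤ → ℂ) (z : Plane) : ℝ :=
  ∑ l : Fin N, ‖∑ j ∈ (propagating_finite α k).toFinset, betaMode α k j *
    (up l j * conj (greenCoeffPlus α k h j z) + um l j * conj (greenCoeffMinus α k h j z))‖ ^ p

/-- The Bessel function of the first kind of order zero. -/
def besselJ0 (x : ℝ) : ℝ := ∑' m : ℕ, (-1) ^ m / ((m ! : ℝ) ^ 2) * (x / 2) ^ (2 * m)

/-- The term of index `j` of the lattice sum of `J₀`; the index `0` is left out. -/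
def latticeTerm (α k : ℝ) (z y : Plane) (j : ℤ) : ℂ :=
  if j = 0 then 0
  else Complex.exp (-Complex.I * (2 * Real.pi * j * α)) *
    (besselJ0 (k * Real.sqrt ((z 0 - y 0 + 2 * j * Real.pi) ^ 2 + (z 1 - y 1) ^ 2)) : ℂ)

/-- The lattice sum `w_α(z, y)`: the series over the nonzero integers, which need not converge
absolutely, is the limit of its sums over `-M ≤ j ≤ M'` as `M, M' → ∞` independently. -/
def latticeSum (α k : ℝ) (z y : Plane) : ℂ :=
  ∑'[SummationFilter.conditional ℤ] j, latticeTerm α k z y j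

end PeriodicScattering

end

/-!
The number `I(z)` sees the scattered fields only through finitely many propagating modes, and so does
the kernel `J₀(k|z - y|) + w_α(z, y)`; the identity is a comparison of these two finite sums.

*The kernel.* Rotating Bessel's integral and substituting `ξ = k sin θ` writes `π J₀(k √(x² + t²))`
as the Fourier integral over `|ξ| < k` of `cos(√(k² - ξ²) t) / √(k² - ξ²)`
(`integrable_waveDensity`). The terms of the quasiperiodic lattice sum are then Fourier coefficients
of this density, and by Poisson summation (`hasSum_poisson`) the sum over all integers is the sum of
the density over the points `α_j`, that is, over the propagating modes
(`besselJ0_add_latticeSum`). The density is only integrable, with singularities at `±k`, so the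
convergence is that of Dini's test at the integers: `β_j ≠ 0` keeps the points `α_j` away from `±k`,
where the density is smooth. After division by `e^{2πis} - 1` the partial sums telescope to two
Fourier coefficients, each of which tends to `0` by the Riemann-Lebesgue lemma; this gives the limit
with independent ends of summation (`hasSum_fourier_at_zero`).

*The Rayleigh coefficients.* For a propagating mode the Helmholtz equation is tested against the plane
waves `e^{-iα_j x₁ ∓ iβ_j x₂}`, cut off horizontally by a partition of unity, which the periodicity
sums to a period cell, and vertically by a function that is `1` for `|x₂| ≤ h`
(`integral_cell_of_isHelmholtzSolution`). The plane wave solves the homogeneous equation, so the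
left-hand side lives in the layers `h ≤ |x₂| ≤ h + 1`. There the field is given by its Rayleigh
expansion, whose `j`-th coefficient is extracted by integrating over a period; one of the two layers
contributes a multiple of the coefficient and the other one nothing (`integral_cell_rayleigh`,
`integral_smoothStep_mul_exp`). Hence `u_j^± = k² ∫_D g_j^±(y) q(y) u(y) dy`
(`rayleigh_coeff_plus`, `rayleigh_coeff_minus`). Multiplication by the conjugate of `g_j^±(z)` and
summation turn the two families into `cos(β_j (z₂ - y₂)) / β_j`, the mode of the kernel
(`greenCoeff_mul_conj`).
-/

noncomputable section

namespace PeriodicScattering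

/-! ### Plane wave representation of `J₀` -/

theorem integral_sin_pow_period (n : ℕ) :
    ∫ θ in (0 : ℝ)..(2 * Real.pi), Real.sin θ ^ n
      = (1 + (-1) ^ n) * ∫ θ in (0 : ℝ)..Real.pi, Real.sin θ ^ n := by
  have hc : Continuous fun θ : ℝ => Real.sin θ ^ n := by fun_prop
  rw [← intervalIntegral.integral_add_adjacent_intervals
    (hc.intervalIntegrable 0 Real.pi) (hc.intervalIntegrable Real.pi (2 * Real.pi))]
  have h : ∫ θ in Real.pi..(2 * Real.pi), Real.sin θ ^ n
      = ∫ θ in (0 : ℝ)..Real.pi, Real.sin (θ + Real.pi) ^ n := by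
    rw [intervalIntegral.integral_comp_add_right (fun θ => Real.sin θ ^ n)]
    congr 1 <;> ring
  rw [h, add_mul, one_mul, ← intervalIntegral.integral_const_mul]
  congr 1
  refine intervalIntegral.integral_congr fun θ _ => ?_
  simp only [Real.sin_add_pi, ← mul_pow]
  ring_nf

theorem prod_odd_div_even (m : ℕ) :
    ∏ i ∈ Finset.range m, (2 * (i : ℝ) + 1) / (2 * i + 2)
      = ((2 * m)! : ℝ) / (4 ^ m * (m ! : ℝ) ^ 2) := by
  induction m with
  | zero => simp
  | succ m ih =>
    rw [Finset.prod_range_succ, ih, show 2 * (m + 1) = 2 * m + 1 + 1 by ring, Nat.factorial_succ,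
      Nat.factorial_succ, Nat.factorial_succ]
    have : (m ! : ℝ) ≠ 0 := by positivity
    push_cast
    field_simp
    ring

/-- Bessel's integral, obtained by integrating the exponential series term by term. -/
theorem integral_exp_sin (r : ℝ) :
    ∫ θ in (0 : ℝ)..(2 * Real.pi), Complex.exp (Complex.I * (r * Real.sin θ : ℝ))
      = 2 * Real.pi * (besselJ0 r : ℂ) := by
  have h1 : HasSum (fun n : ℕ => ∫ θ in (0 : ℝ)..(2 * Real.pi),
      ((n ! : ℂ))⁻¹ * (Complex.I * (r * Real.sin θ : ℝ)) ^ n)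
      (∫ θ in (0 : ℝ)..(2 * Real.pi), Complex.exp (Complex.I * (r * Real.sin θ : ℝ))) := by
    refine intervalIntegral.hasSum_integral_of_dominated_convergence
      (fun n _ => ((n ! : ℝ))⁻¹ * |r| ^ n) ?_ ?_ ?_ ?_ ?_
    · intro n
      exact (by fun_prop : Continuous fun θ : ℝ =>
        ((n ! : ℂ))⁻¹ * (Complex.I * (r * Real.sin θ : ℝ)) ^ n).aestronglyMeasurable
    · intro n
      refine Filter.Eventually.of_forall fun θ _ => ?_
      rw [norm_mul, norm_pow, norm_mul, Complex.norm_I, one_mul, norm_inv, Complex.norm_natCast,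
        Complex.norm_real, Real.norm_eq_abs, abs_mul]
      gcongr
      exact mul_le_of_le_one_right (abs_nonneg _) (Real.abs_sin_le_one θ)
    · refine Filter.Eventually.of_forall fun θ _ => ?_
      simpa [div_eq_inv_mul] using Real.summable_pow_div_factorial |r|
    · exact intervalIntegrable_const
    · refine Filter.Eventually.of_forall fun θ _ => ?_
      have := NormedSpace.exp_series_hasSum_exp' (𝕂 := ℂ) (Complex.I * (r * Real.sin θ : ℝ))
      rw [← Complex.exp_eq_exp_ℂ] at this
      simpa [smul_eq_mul] using this
  have h2 : ∀ n : ℕ, ∫ θ in (0 : ℝ)..(2 * Real.pi),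
      ((n ! : ℂ))⁻¹ * (Complex.I * (r * Real.sin θ : ℝ)) ^ n
      = (n ! : ℂ)⁻¹ * (Complex.I * r) ^ n *
        (((1 + (-1) ^ n) * ∫ θ in (0 : ℝ)..Real.pi, Real.sin θ ^ n : ℝ) : ℂ) := by
    intro n
    rw [← integral_sin_pow_period, ← intervalIntegral.integral_ofReal,
      ← intervalIntegral.integral_const_mul]
    refine intervalIntegral.integral_congr fun θ _ => ?_
    push_cast
    ring
  simp_rw [h2] at h1
  have hinj : Function.Injective fun m : ℕ => 2 * m := fun a b h => by simpa using h
  rw [← hinj.hasSum_iff] at h1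
  · have h3 : ∀ m : ℕ, ((fun n : ℕ => (n ! : ℂ)⁻¹ * (Complex.I * r) ^ n *
        (((1 + (-1) ^ n) * ∫ θ in (0 : ℝ)..Real.pi, Real.sin θ ^ n : ℝ) : ℂ)) ∘ fun m => 2 * m) m
        = ((2 * Real.pi * ((-1) ^ m / ((m ! : ℝ) ^ 2) * (r / 2) ^ (2 * m)) : ℝ) : ℂ) := by
      intro m
      simp only [Function.comp_apply]
      rw [integral_sin_pow_even, prod_odd_div_even, mul_pow, pow_mul Complex.I, Complex.I_sq,
        pow_mul (-1 : ℝ) 2, div_pow, pow_mul (2 : ℝ) 2]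
      have h4 : ((2 * m)! : ℂ) ≠ 0 := by exact_mod_cast Nat.factorial_ne_zero _
      have h5 : (m ! : ℂ) ≠ 0 := by exact_mod_cast Nat.factorial_ne_zero _
      push_cast
      norm_num
      field_simp
    rw [funext h3] at h1
    rw [← h1.tsum_eq, ← Complex.ofReal_tsum, tsum_mul_left, besselJ0]
    push_cast
    ring
  · intro n hn
    have : Odd n := by
      rcases Nat.even_or_odd n with h | h
      · exact absurd ⟨n / 2, by obtain ⟨c, rfl⟩ := h; change 2 * ((c + c) / 2) = c + c; omega⟩ hn
      · exact h
    simp [this.neg_one_pow]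

/-- `J₀` as a superposition of plane waves of all directions, by rotating Bessel's integral. -/
theorem integral_plane_waves (k x t : ℝ) :
    ∫ θ in (0 : ℝ)..(2 * Real.pi),
        Complex.exp (Complex.I * (k * (x * Real.sin θ + t * Real.cos θ) : ℝ))
      = 2 * Real.pi * (besselJ0 (k * Real.sqrt (x ^ 2 + t ^ 2)) : ℂ) := by
  rw [← integral_exp_sin]
  set z : ℂ := ⟨x, t⟩ with hz
  have hr : Real.sqrt (x ^ 2 + t ^ 2) = ‖z‖ := by
    rw [Complex.norm_def, Complex.normSq_apply]; simp [hz, sq]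
  have hx : x = ‖z‖ * Real.cos z.arg := by rw [Complex.norm_mul_cos_arg]
  have ht : t = ‖z‖ * Real.sin z.arg := by rw [Complex.norm_mul_sin_arg]
  set F : ℝ → ℂ := fun θ => Complex.exp (Complex.I * (k * Real.sqrt (x ^ 2 + t ^ 2) * Real.sin θ : ℝ))
    with hF
  have hper : Function.Periodic F (2 * Real.pi) := fun θ => by simp only [hF, Real.sin_add_two_pi]
  have h1 : ∀ θ, Complex.exp (Complex.I * (k * (x * Real.sin θ + t * Real.cos θ) : ℝ))
      = F (θ + z.arg) := by
    intro θ
    simp only [hF, hr]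
    congr 3
    rw [Real.sin_add]
    nth_rw 1 [hx, ht]
    ring
  simp_rw [h1]
  rw [intervalIntegral.integral_comp_add_right F, add_comm (2 * Real.pi), zero_add,
    hper.intervalIntegral_add_eq z.arg 0, zero_add]

/-- The plane waves of directions `θ` and `π - θ` add up to a horizontal wave times a cosine in the
vertical variable. -/
theorem integral_half_plane_waves (k x t : ℝ) :
    ∫ θ in (-(Real.pi / 2))..(Real.pi / 2),
        Complex.exp (Complex.I * (k * Real.sin θ * x : ℝ)) * (Real.cos (k * Real.cos θ * t) : ℂ)
      = Real.pi * (besselJ0 (k * Real.sqrt (x ^ 2 + t ^ 2)) : ℂ) := by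
  have h := integral_plane_waves k x t
  set F : ℝ → ℂ := fun θ => Complex.exp (Complex.I * (k * (x * Real.sin θ + t * Real.cos θ) : ℝ))
    with hF
  have hc : Continuous F := by fun_prop
  have hper : Function.Periodic F (2 * Real.pi) := fun θ => by
    simp only [hF, Real.sin_add_two_pi, Real.cos_add_two_pi]
  have h2 : ∫ θ in (0 : ℝ)..(2 * Real.pi), F θ
      = ∫ θ in (-(Real.pi / 2))..(-(Real.pi / 2) + 2 * Real.pi), F θ := by
    have := hper.intervalIntegral_add_eq 0 (-(Real.pi / 2))
    rwa [zero_add] at this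
  have h3 : ∫ θ in (Real.pi / 2)..(-(Real.pi / 2) + 2 * Real.pi), F θ
      = ∫ θ in (-(Real.pi / 2))..(Real.pi / 2), F (Real.pi - θ) := by
    rw [intervalIntegral.integral_comp_sub_left F]
    congr 1 <;> ring
  rw [h2, ← intervalIntegral.integral_add_adjacent_intervals
    (hc.intervalIntegrable _ (Real.pi / 2)) (hc.intervalIntegrable (Real.pi / 2) _), h3,
    ← intervalIntegral.integral_add (hc.intervalIntegrable _ _)
      ((by fun_prop : Continuous fun θ => F (Real.pi - θ)).intervalIntegrable _ _)] at h
  have h4 : ∀ θ, F θ + F (Real.pi - θ)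
      = 2 * (Complex.exp (Complex.I * (k * Real.sin θ * x : ℝ)) *
        (Real.cos (k * Real.cos θ * t) : ℂ)) := by
    intro θ
    simp only [hF, Real.sin_pi_sub, Real.cos_pi_sub]
    rw [Complex.ofReal_cos, Complex.cos]
    have e1 : Complex.I * ((k * (x * Real.sin θ + t * Real.cos θ) : ℝ) : ℂ)
        = Complex.I * (k * Real.sin θ * x : ℝ) + (k * Real.cos θ * t : ℝ) * Complex.I := by
      push_cast; ring
    have e2 : Complex.I * ((k * (x * Real.sin θ + t * -Real.cos θ) : ℝ) : ℂ)
        = Complex.I * (k * Real.sin θ * x : ℝ) + -((k * Real.cos θ * t : ℝ) : ℂ) * Complex.I := by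
      push_cast; ring
    rw [e1, e2, Complex.exp_add, Complex.exp_add]
    ring
  simp_rw [h4, intervalIntegral.integral_const_mul] at h
  have h5 : (2 : ℂ) ≠ 0 := two_ne_zero
  apply mul_left_cancel₀ h5
  rw [h]; ring

/-- The density, on the horizontal wave numbers `ξ`, of `π J₀(k √(x² + t²))` as a superposition of
the waves `e^{iξx} cos(√(k² - ξ²) t)`. For `|ξ| ≥ k` the value is `0`, as it should be, because then
`√(k² - ξ²) = 0` and the quotient is a division by zero. -/
def waveDensity (k x t ξ : ℝ) : ℂ :=
  Complex.exp (Complex.I * (ξ * x : ℝ)) *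
    ((Real.cos (Real.sqrt (k ^ 2 - ξ ^ 2) * t) / Real.sqrt (k ^ 2 - ξ ^ 2) : ℝ) : ℂ)

theorem waveDensity_eq_zero {k ξ : ℝ} (x t : ℝ) (h : k ^ 2 ≤ ξ ^ 2) : waveDensity k x t ξ = 0 := by
  simp [waveDensity, Real.sqrt_eq_zero_of_nonpos (sub_nonpos.2 h)]

/-- The substitution `ξ = k sin θ`, whose Jacobian `k cos θ = √(k² - ξ²)` cancels the singularity of
the density at `ξ = ±k`. -/
theorem integrable_waveDensity {k : ℝ} (hk : 0 < k) (x t : ℝ) :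
    Integrable (waveDensity k x t) ∧
      ∫ ξ, waveDensity k x t ξ = Real.pi * (besselJ0 (k * Real.sqrt (x ^ 2 + t ^ 2)) : ℂ) := by
  have hpi := Real.pi_pos
  set s : Set ℝ := Set.Ioo (-(Real.pi / 2)) (Real.pi / 2) with hs
  have hinj : Set.InjOn (fun θ => k * Real.sin θ) s := by
    intro a ha b hb hab
    exact Real.injOn_sin ⟨ha.1.le, ha.2.le⟩ ⟨hb.1.le, hb.2.le⟩
      (mul_left_cancel₀ hk.ne' hab)
  have himg : (fun θ => k * Real.sin θ) '' s = Set.Ioo (-k) k := by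
    ext ξ
    constructor
    · rintro ⟨θ, hθ, rfl⟩
      have hcos := Real.cos_pos_of_mem_Ioo hθ
      have := Real.sin_sq_add_cos_sq θ
      have h1 : Real.sin θ < 1 := by nlinarith [Real.sin_le_one θ]
      have h2 : -1 < Real.sin θ := by nlinarith [Real.neg_one_le_sin θ]
      constructor <;> simp only <;> nlinarith
    · rintro ⟨h1, h2⟩
      have h3 : -1 < ξ / k := by rw [lt_div_iff₀ hk]; linarith
      have h4 : ξ / k < 1 := by rw [div_lt_iff₀ hk]; linarith
      refine ⟨Real.arcsin (ξ / k), ⟨Real.neg_pi_div_two_lt_arcsin.2 h3,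
        Real.arcsin_lt_pi_div_two.2 h4⟩, ?_⟩
      simp only
      rw [Real.sin_arcsin h3.le h4.le]
      field_simp
  have hder : ∀ θ ∈ s, HasDerivWithinAt (fun θ => k * Real.sin θ) (k * Real.cos θ) s θ :=
    fun θ _ => ((Real.hasDerivAt_sin θ).const_mul k).hasDerivWithinAt
  have hval : Set.EqOn (fun θ => |k * Real.cos θ| • waveDensity k x t (k * Real.sin θ))
      (fun θ => Complex.exp (Complex.I * (k * Real.sin θ * x : ℝ)) *
        (Real.cos (k * Real.cos θ * t) : ℂ)) s := by
    intro θ hθ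
    have hcos := mul_pos hk (Real.cos_pos_of_mem_Ioo hθ)
    have hsq : Real.sqrt (k ^ 2 - (k * Real.sin θ) ^ 2) = k * Real.cos θ := by
      rw [← Real.sqrt_sq hcos.le]
      congr 1
      rw [mul_pow, mul_pow, Real.cos_sq']
      ring
    simp only [waveDensity, hsq, abs_of_pos hcos, Complex.real_smul]
    have : ((k * Real.cos θ : ℝ) : ℂ) ≠ 0 := by exact_mod_cast hcos.ne'
    rw [Complex.ofReal_div]
    field_simp
  have hcont : Continuous fun θ : ℝ => Complex.exp (Complex.I * (k * Real.sin θ * x : ℝ)) *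
        (Real.cos (k * Real.cos θ * t) : ℂ) := by fun_prop
  have hsupp : ∀ ξ ∉ Set.Ioo (-k) k, waveDensity k x t ξ = 0 := by
    intro ξ hξ
    apply waveDensity_eq_zero
    by_contra! hlt
    exact hξ (abs_lt.1 (abs_lt_of_sq_lt_sq hlt hk.le))
  have hint : IntegrableOn (waveDensity k x t) (Set.Ioo (-k) k) := by
    rw [← himg, integrableOn_image_iff_integrableOn_abs_deriv_smul measurableSet_Ioo hder hinj,
      integrableOn_congr_fun hval measurableSet_Ioo]
    exact (hcont.integrableOn_Icc).mono_set Set.Ioo_subset_Icc_self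
  refine ⟨(integrableOn_iff_integrable_of_support_subset fun ξ hξ => ?_).1 hint, ?_⟩
  · by_contra hcon
    exact hξ (hsupp ξ hcon)
  · rw [← setIntegral_eq_integral_of_forall_compl_eq_zero hsupp, ← himg,
      integral_image_eq_integral_abs_deriv_smul measurableSet_Ioo hder hinj,
      setIntegral_congr_fun measurableSet_Ioo hval, ← integral_Ioc_eq_integral_Ioo,
      ← intervalIntegral.integral_of_le (by linarith), integral_half_plane_waves]

/-! ### Poisson summation and the lattice sum of `J₀` -/

/-- The character `s ↦ e^{2πijs}` of the circle. -/
def character (j : ℤ) (s : ℝ) : ℂ := Complex.exp (2 * Real.pi * Complex.I * (j * s : ℝ))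

theorem norm_character (j : ℤ) (s : ℝ) : ‖character j s‖ = 1 := by
  rw [character, show 2 * (Real.pi : ℂ) * Complex.I * ((j * s : ℝ) : ℂ)
    = ((2 * Real.pi * (j * s) : ℝ) : ℂ) * Complex.I by push_cast; ring, Complex.norm_exp_ofReal_mul_I]

theorem continuous_character (j : ℤ) : Continuous (character j) := by
  unfold character; fun_prop

theorem character_add_int (j m : ℤ) (s : ℝ) : character j (m + s) = character j s := by
  rw [character, character, Complex.exp_eq_exp_iff_exists_int]
  exact ⟨j * m, by push_cast; ring⟩

theorem character_add (i j : ℤ) (s : ℝ) : character (i + j) s = character i s * character j s := by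
  rw [character, character, character, ← Complex.exp_add]
  congr 1
  push_cast; ring

theorem character_zero_left (s : ℝ) : character 0 s = 1 := by simp [character]

theorem sum_character_mul {a b : ℤ} (hab : a ≤ b) (s : ℝ) :
    (∑ j ∈ Finset.Icc a b, character j s) * (character 1 s - 1)
      = character (b + 1) s - character a s := by
  induction b, hab using Int.leInduction with
  | base => simp [character_add]; ring
  | succ b hab ih =>
    have : Finset.Icc a (b + 1) = insert (b + 1) (Finset.Icc a b) := by
      ext x; simp only [Finset.mem_Icc, Finset.mem_insert]; omega
    rw [this, Finset.sum_insert (by simp), add_mul, ih, character_add (b + 1) 1]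
    ring

theorem norm_character_one_sub_one {s : ℝ} (hs : |s| ≤ 1 / 2) :
    4 * |s| ≤ ‖character 1 s - 1‖ := by
  have h1 : ‖character 1 s - 1‖ = 2 * |Real.sin (Real.pi * s)| := by
    have := Complex.norm_exp_I_mul_ofReal_sub_one (2 * Real.pi * s)
    rw [character, show 2 * (Real.pi : ℂ) * Complex.I * (((1 : ℤ) * s : ℝ) : ℂ)
      = Complex.I * ((2 * Real.pi * s : ℝ) : ℂ) by push_cast; ring, this, Real.norm_eq_abs, abs_mul,
      abs_two]
    congr 3
    ring
  have h2 : |Real.pi * s| ≤ Real.pi / 2 := by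
    rw [abs_mul, abs_of_pos Real.pi_pos]; nlinarith [Real.pi_pos]
  have h3 := Real.mul_abs_le_abs_sin h2
  rw [h1]
  have h4 : 2 / Real.pi * |Real.pi * s| = 2 * |s| := by
    rw [abs_mul, abs_of_pos Real.pi_pos]; field_simp
  linarith

theorem tendsto_integral_mul_character {H : ℝ → ℂ} {l : Filter ℤ}
    (hl : Filter.Tendsto (fun j : ℤ => (j : ℝ)) l (Filter.cocompact ℝ))
    (S : Set ℝ) (hS : MeasurableSet S) :
    Filter.Tendsto (fun j : ℤ => ∫ s in S, H s * character j s) l (nhds 0) := by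
  have h := Real.tendsto_integral_exp_smul_cocompact (S.indicator H)
  have hneg : Filter.Tendsto (fun j : ℤ => -(j : ℝ)) l (Filter.cocompact ℝ) := by
    have : Filter.Tendsto (fun x : ℝ => -x) (Filter.cocompact ℝ) (Filter.cocompact ℝ) :=
      (Homeomorph.neg ℝ).isClosedEmbedding.tendsto_cocompact
    exact this.comp hl
  refine (h.comp hneg).congr fun j => ?_
  rw [← integral_indicator hS]
  refine integral_congr_ae (Filter.Eventually.of_forall fun s => ?_)
  by_cases hs : s ∈ S
  · simp only [Set.indicator_of_mem hs]
    rw [Circle.smul_def, Real.fourierChar_apply, smul_eq_mul, mul_comm, character]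
    congr 2
    push_cast; ring
  · simp [hs]

theorem integral_character (j : ℤ) :
    ∫ s in Set.Ioc (-(1 / 2) : ℝ) (1 / 2), character j s = if j = 0 then 1 else 0 := by
  rw [← intervalIntegral.integral_of_le (by norm_num)]
  split_ifs with hj
  · subst hj
    simp only [character_zero_left]
    rw [intervalIntegral.integral_const]; norm_num
  · have hc : (2 * Real.pi * Complex.I * j : ℂ) ≠ 0 := by
      simp [hj, Real.pi_ne_zero]
    have : ∀ s : ℝ, character j s = Complex.exp (2 * Real.pi * Complex.I * j * s) := fun s => by
      rw [character]; congr 1; push_cast; ring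
    simp_rw [this]
    rw [integral_exp_mul_complex hc, div_eq_zero_iff]
    left
    rw [sub_eq_zero, Complex.exp_eq_exp_iff_exists_int]
    exact ⟨j, by push_cast; ring⟩

/-- Dini's test at an interior point: where `g` is differentiable, its Fourier series converges to
the value of `g`. After division of `g - g 0` by `e^{2πis} - 1`, which leaves an integrable
function, the partial sums telescope to two Fourier coefficients, and these tend to `0` separately
by the Riemann-Lebesgue lemma; so the two ends of the sum are independent. -/
theorem hasSum_fourier_at_zero {g : ℝ → ℂ} (hg : IntegrableOn g (Set.Ioc (-(1 / 2)) (1 / 2)))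
    (hd : DifferentiableAt ℝ g 0) :
    HasSum (fun j : ℤ => ∫ s in Set.Ioc (-(1 / 2) : ℝ) (1 / 2), g s * character j s) (g 0)
      (SummationFilter.conditional ℤ) := by
  set I : Set ℝ := Set.Ioc (-(1 / 2)) (1 / 2) with hI
  have hImeas : MeasurableSet I := measurableSet_Ioc
  set H : ℝ → ℂ := fun s => (g s - g 0) / (character 1 s - 1) with hH
  obtain ⟨C, hC⟩ := hd.hasFDerivAt.isBigO_sub.bound
  obtain ⟨δ, hδ, hball⟩ := Metric.eventually_nhds_iff.1 hC
  have hconst : IntegrableOn (fun _ : ℝ => g 0) I := integrableOn_const (by simp [hI])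
  -- Near `0` the quotient is bounded because `g` is differentiable there; elsewhere the denominator
  -- is bounded away from `0`.
  have hHint : IntegrableOn H I := by
    have hbound : IntegrableOn (fun s => |C| / 4 + (‖g s‖ + ‖g 0‖) / (4 * δ)) I :=
      (integrableOn_const (by simp [hI])).add ((hg.norm.add hconst.norm).div_const _)
    refine Integrable.mono' hbound ?_ ?_
    · exact (hg.aestronglyMeasurable.sub aestronglyMeasurable_const).div₀
        ((continuous_character 1).aestronglyMeasurable.sub aestronglyMeasurable_const)
    · filter_upwards [ae_restrict_mem hImeas] with s hs
      have hs' : |s| ≤ 1 / 2 := abs_le.2 ⟨hs.1.le, hs.2⟩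
      have hden := norm_character_one_sub_one hs'
      rcases eq_or_ne s 0 with rfl | hs0
      · simp only [hH, sub_self, zero_div, norm_zero]; positivity
      have hspos : 0 < |s| := abs_pos.2 hs0
      rw [hH, norm_div]
      rcases lt_or_ge |s| δ with hlt | hge
      · have h1 : ‖g s - g 0‖ ≤ |C| * |s| := by
          have := hball (y := s) (by simpa using hlt)
          rw [sub_zero, Real.norm_eq_abs] at this
          exact this.trans (by gcongr; exact le_abs_self C)
        calc ‖g s - g 0‖ / ‖character 1 s - 1‖ ≤ (|C| * |s|) / (4 * |s|) := by gcongr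
          _ = |C| / 4 := by field_simp
          _ ≤ _ := by have : 0 ≤ (‖g s‖ + ‖g 0‖) / (4 * δ) := by positivity
                      linarith
      · calc ‖g s - g 0‖ / ‖character 1 s - 1‖ ≤ (‖g s‖ + ‖g 0‖) / (4 * δ) := by
              gcongr
              · exact norm_sub_le _ _
              · linarith
          _ ≤ _ := by have : 0 ≤ |C| / 4 := by positivity
                      linarith
  have hsub : IntegrableOn (fun s => g s - g 0) I := hg.sub hconst
  have hmul : ∀ {f : ℝ → ℂ}, IntegrableOn f I → ∀ j, IntegrableOn (fun s => f s * character j s) I :=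
    fun hf j => Integrable.mul_bdd (c := 1) hf (continuous_character j).aestronglyMeasurable
      (Filter.Eventually.of_forall fun s => (norm_character j s).le)
  have hpartial : ∀ a b : ℤ, a ≤ 0 → 0 ≤ b →
      ∑ j ∈ Finset.Icc a b, ∫ s in I, g s * character j s
        = g 0 + ((∫ s in I, H s * character (b + 1) s) - ∫ s in I, H s * character a s) := by
    intro a b ha hb
    have h1 : ∀ j, ∫ s in I, g s * character j s
        = (∫ s in I, (g s - g 0) * character j s) + g 0 * ∫ s in I, character j s := by
      intro j
      rw [← integral_const_mul, ← integral_add (hmul hsub j) (hmul hconst j)]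
      simp only [sub_mul, sub_add_cancel]
    simp_rw [h1, Finset.sum_add_distrib, ← Finset.mul_sum, hI, integral_character, ← hI]
    rw [Finset.sum_ite_eq' , if_pos (Finset.mem_Icc.2 ⟨ha, hb⟩), mul_one, add_comm,
      ← integral_finsetSum _ (fun j _ => hmul hsub j),
      ← integral_sub (hmul hHint _) (hmul hHint _)]
    congr 1
    refine setIntegral_congr_fun hImeas fun s hs => ?_
    have hs' : |s| ≤ 1 / 2 := abs_le.2 ⟨hs.1.le, hs.2⟩
    rcases eq_or_ne s 0 with rfl | hs0
    · simp [hH]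
    have hne : character 1 s - 1 ≠ 0 := by
      rw [← norm_pos_iff]
      have := norm_character_one_sub_one hs'
      have := abs_pos.2 hs0
      linarith
    simp only [hH, ← Finset.mul_sum, ← mul_sub]
    rw [← sum_character_mul (ha.trans hb)]
    field_simp
  unfold HasSum
  rw [SummationFilter.conditional_filter, Filter.tendsto_map'_iff]
  have htop : Filter.Tendsto (fun j : ℤ => (j : ℝ)) Filter.atTop (Filter.cocompact ℝ) :=
    tendsto_intCast_atTop_atTop.mono_right atTop_le_cocompact
  have hbot : Filter.Tendsto (fun j : ℤ => (j : ℝ)) Filter.atBot (Filter.cocompact ℝ) :=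
    tendsto_intCast_atBot_iff.2 Filter.tendsto_id |>.mono_right atBot_le_cocompact
  have hA := (tendsto_integral_mul_character (H := H) htop I hImeas).comp
    (Filter.tendsto_atTop_add_const_right Filter.atTop (1 : ℤ) Filter.tendsto_id)
  have hB := tendsto_integral_mul_character (H := H) hbot I hImeas
  have hlim := (tendsto_const_nhds (x := g 0)).add
    ((hA.comp (Filter.tendsto_snd (f := Filter.atBot))).sub
      (hB.comp (Filter.tendsto_fst (g := Filter.atTop))))
  rw [sub_zero, add_zero] at hlim
  refine hlim.congr' ?_
  filter_upwards [(Filter.eventually_le_atBot (0 : ℤ)).prod_mk (Filter.eventually_ge_atTop (0 : ℤ))]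
    with ⟨a, b⟩ hab
  exact (hpartial a b hab.1 hab.2).symm

/-- Poisson summation for a compactly supported density that is differentiable at the integers. -/
theorem hasSum_poisson {g : ℝ → ℂ} (hg : Integrable g) {T : Finset ℤ}
    (hsupp : ∀ s, g s ≠ 0 → ∃ m ∈ T, s ∈ Set.Ioc (-(1 / 2) + m : ℝ) (-(1 / 2) + m + 1))
    (hd : ∀ m : ℤ, DifferentiableAt ℝ g m) :
    HasSum (fun j : ℤ => ∫ s, g s * character j s) (∑ m ∈ T, g m)
      (SummationFilter.conditional ℤ) := by
  have h1 : ∀ m : ℤ, HasSum (fun j : ℤ => ∫ s in Set.Ioc (-(1 / 2) : ℝ) (1 / 2),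
      g (m + s) * character j s) (g m) (SummationFilter.conditional ℤ) := by
    intro m
    have hd' : DifferentiableAt ℝ (fun s : ℝ => g (m + s)) 0 := by
      have h0 : DifferentiableAt ℝ g ((m : ℝ) + 0) := by simpa using hd m
      exact h0.comp (0 : ℝ) (by fun_prop)
    simpa using hasSum_fourier_at_zero (g := fun s => g (m + s))
      (hg.comp_add_left (m : ℝ)).integrableOn hd'
  refine (hasSum_sum (s := T) fun m _ => h1 m).congr_fun fun j => ?_
  have hgj : Integrable fun s => g s * character j s :=
    Integrable.mul_bdd (c := 1) hg (continuous_character j).aestronglyMeasurable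
      (Filter.Eventually.of_forall fun s => (norm_character j s).le)
  have hcompl : ∀ s ∉ ⋃ m ∈ T, Set.Ioc (-(1 / 2) + m : ℝ) (-(1 / 2) + m + 1),
      g s * character j s = 0 := by
    intro s hs
    by_contra hne
    obtain ⟨m, hm, hsm⟩ := hsupp s (left_ne_zero_of_mul hne)
    exact hs (Set.mem_biUnion hm hsm)
  rw [← setIntegral_eq_integral_of_forall_compl_eq_zero hcompl,
    integral_biUnion_finset T (fun _ _ => measurableSet_Ioc)
      (fun a _ b _ hab => Set.pairwise_disjoint_Ioc_add_intCast (-(1 / 2) : ℝ) hab)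
      (fun _ _ => hgj.integrableOn)]
  refine Finset.sum_congr rfl fun m _ => ?_
  rw [← intervalIntegral.integral_of_le (by linarith), ← intervalIntegral.integral_of_le (by norm_num)]
  have hshift : ∀ s : ℝ, g (m + s) * character j s = g (m + s) * character j (m + s) := fun s => by
    rw [character_add_int]
  simp only [hshift]
  rw [intervalIntegral.integral_comp_add_left (fun s => g s * character j s)]
  congr 1 <;> ring

theorem mem_propagating_iff {α k : ℝ} {j : ℤ} :
    j ∈ propagating α k ↔ alphaMode α j ^ 2 < k ^ 2 := by
  by_cases h : alphaMode α j ^ 2 ≤ k ^ 2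
  · simp only [propagating, betaMode, if_pos h, Set.mem_ofPred_eq, Complex.ofReal_im,
      Complex.ofReal_re, true_and, Real.sqrt_pos, sub_pos]
  · simp [propagating, betaMode, h, le_of_not_ge h]

theorem betaMode_of_propagating {α k : ℝ} {j : ℤ} (hj : j ∈ propagating α k) :
    betaMode α k j = (Real.sqrt (k ^ 2 - alphaMode α j ^ 2) : ℂ) :=
  if_pos (mem_propagating_iff.1 hj).le

theorem alphaMode_sq_ne {α k : ℝ} {j : ℤ} (h : betaMode α k j ≠ 0) :
    alphaMode α j ^ 2 ≠ k ^ 2 := by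
  intro heq
  exact h (by simp [betaMode, heq])

theorem differentiableAt_waveDensity {k ξ : ℝ} (x t : ℝ) (h : ξ ^ 2 ≠ k ^ 2) :
    DifferentiableAt ℝ (waveDensity k x t) ξ := by
  rcases lt_or_gt_of_ne h with hlt | hgt
  · have hpos : 0 < k ^ 2 - ξ ^ 2 := sub_pos.2 hlt
    have h1 : DifferentiableAt ℝ (fun ξ : ℝ => Real.sqrt (k ^ 2 - ξ ^ 2)) ξ :=
      DifferentiableAt.sqrt (by fun_prop) hpos.ne'
    have h2 : DifferentiableAt ℝ (fun ξ : ℝ =>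
        Real.cos (Real.sqrt (k ^ 2 - ξ ^ 2) * t) / Real.sqrt (k ^ 2 - ξ ^ 2)) ξ :=
      (h1.mul_const t).cos.fun_div h1 (Real.sqrt_pos.2 hpos).ne'
    have h3 : DifferentiableAt ℝ (fun ξ : ℝ => ((Real.cos (Real.sqrt (k ^ 2 - ξ ^ 2) * t) /
        Real.sqrt (k ^ 2 - ξ ^ 2) : ℝ) : ℂ)) ξ :=
      Complex.ofRealCLM.differentiableAt.comp ξ h2
    have h4 : DifferentiableAt ℝ (fun ξ : ℝ => Complex.exp (Complex.I * (ξ * x : ℝ))) ξ := by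
      have : DifferentiableAt ℝ (fun ξ : ℝ => Complex.I * ((ξ * x : ℝ) : ℂ)) ξ :=
        (Complex.ofRealCLM.differentiableAt.comp ξ
          (by fun_prop : DifferentiableAt ℝ (fun ξ : ℝ => ξ * x) ξ)).const_mul _
      exact this.cexp
    exact h4.mul h3
  · have : waveDensity k x t =ᶠ[nhds ξ] fun _ => 0 := by
      have hopen : IsOpen {ξ : ℝ | k ^ 2 < ξ ^ 2} := isOpen_lt continuous_const (by fun_prop)
      filter_upwards [hopen.mem_nhds hgt] with η hη
      exact waveDensity_eq_zero x t (le_of_lt hη)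
    exact this.differentiableAt_iff.2 (differentiableAt_const _)

/-- The quasiperiodic lattice sum of `J₀`, all integers included, is a finite sum over the
propagating modes: Poisson summation applied to the density of `J₀` on the wave numbers. -/
theorem hasSum_besselJ0_lattice {α k : ℝ} (hk : 0 < k) (hβ : ∀ j : ℤ, betaMode α k j ≠ 0)
    (x t : ℝ) :
    HasSum (fun j : ℤ => Complex.exp (-Complex.I * (2 * Real.pi * j * α)) *
        (besselJ0 (k * Real.sqrt ((x + 2 * j * Real.pi) ^ 2 + t ^ 2)) : ℂ))
      (∑ j ∈ (propagating_finite α k).toFinset, (Real.pi : ℂ)⁻¹ * waveDensity k x t (alphaMode α j))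
      (SummationFilter.conditional ℤ) := by
  set g : ℝ → ℂ := fun s => waveDensity k x t (α + s) with hg
  -- The density vanishes for `|α + s| ≥ k`, so the unit intervals centred at `|m| ≤ K` cover its
  -- support.
  set K : ℤ := ⌈k + |α|⌉ + 1 with hK
  have hKle : k + |α| + 1 ≤ K := by rw [hK]; push_cast; linarith [Int.le_ceil (k + |α|)]
  have hbound : ∀ s, (α + s) ^ 2 < k ^ 2 → |s| < k + |α| := by
    intro s hs
    have h1 := abs_lt_of_sq_lt_sq hs hk.le
    have h2 : |s| ≤ |α + s| + |α| := by
      calc |s| = |(α + s) - α| := by ring_nf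
        _ ≤ _ := abs_sub _ _
    linarith
  have hlt : ∀ s, g s ≠ 0 → (α + s) ^ 2 < k ^ 2 := fun s hs => by
    by_contra! hge
    exact hs (waveDensity_eq_zero x t hge)
  have hP := hasSum_poisson (g := g) (T := Finset.Icc (-K) K)
    ((integrable_waveDensity hk x t).1.comp_add_left α) (fun s hs => by
      have hs' := abs_lt.1 (hbound s (hlt s hs))
      have h1 := Int.le_ceil (s - 1 / 2)
      have h2 := Int.ceil_lt_add_one (s - 1 / 2)
      refine ⟨⌈s - 1 / 2⌉, Finset.mem_Icc.2 ⟨?_, ?_⟩, ?_, ?_⟩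
      · have : (-K : ℝ) ≤ (⌈s - 1 / 2⌉ : ℝ) := by linarith
        exact_mod_cast this
      · have : (⌈s - 1 / 2⌉ : ℝ) ≤ (K : ℝ) := by linarith
        exact_mod_cast this
      · linarith
      · linarith) (fun m => by
      have := differentiableAt_waveDensity x t (alphaMode_sq_ne (hβ m))
      exact DifferentiableAt.comp (m : ℝ) this (by fun_prop))
  have hsum : ∑ m ∈ Finset.Icc (-K) K, g m
      = ∑ j ∈ (propagating_finite α k).toFinset, waveDensity k x t (alphaMode α j) := by
    symm
    refine Finset.sum_subset (fun j hj => ?_) (fun j _ hj => ?_)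
    · have := mem_propagating_iff.1 ((Set.Finite.mem_toFinset _).1 hj)
      have h1 := abs_lt.1 (hbound j this)
      refine Finset.mem_Icc.2 ⟨?_, ?_⟩
      · have : (-K : ℝ) ≤ (j : ℝ) := by linarith
        exact_mod_cast this
      · have : (j : ℝ) ≤ (K : ℝ) := by linarith
        exact_mod_cast this
    · rw [Set.Finite.mem_toFinset, mem_propagating_iff, not_lt] at hj
      exact waveDensity_eq_zero x t hj
  rw [hsum] at hP
  rw [← Finset.mul_sum]
  refine (hP.mul_left (Real.pi : ℂ)⁻¹).congr_fun fun j => ?_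
  have hpi : (Real.pi : ℂ) ≠ 0 := by exact_mod_cast Real.pi_ne_zero
  have h1 : ∀ s, g s * character j s = Complex.exp (-Complex.I * (2 * Real.pi * j * α)) *
      waveDensity k (x + 2 * j * Real.pi) t (α + s) := by
    intro s
    simp only [hg, waveDensity, character]
    rw [mul_right_comm, ← Complex.exp_add, ← mul_assoc, ← Complex.exp_add]
    congr 2
    push_cast; ring
  simp_rw [h1]
  rw [integral_const_mul, integral_add_left_eq_self (fun s => waveDensity k _ t s) α,
    (integrable_waveDensity hk _ t).2]
  field_simp

theorem hasSum_latticeTerm {α k : ℝ} (hk : 0 < k) (hβ : ∀ j : ℤ, betaMode α k j ≠ 0)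
    (z y : Plane) :
    HasSum (latticeTerm α k z y)
      ((∑ j ∈ (propagating_finite α k).toFinset,
        (Real.pi : ℂ)⁻¹ * waveDensity k (z 0 - y 0) (z 1 - y 1) (alphaMode α j))
          - besselJ0 (k * ‖z - y‖)) (SummationFilter.conditional ℤ) := by
  have h1 := hasSum_besselJ0_lattice hk hβ (z 0 - y 0) (z 1 - y 1)
  have h2 := hasSum_ite_eq (0 : ℤ) ((besselJ0 (k * ‖z - y‖) : ℝ) : ℂ)
    (SummationFilter.conditional ℤ)
  refine (h1.sub h2).congr_fun fun j => ?_
  rw [latticeTerm]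
  split_ifs with hj
  · subst hj
    have : ‖z - y‖ = Real.sqrt ((z 0 - y 0) ^ 2 + (z 1 - y 1) ^ 2) := by
      simp [EuclideanSpace.norm_eq]
    simp [this]
  · simp

/-- The kernel of the indicator function is the superposition of the propagating modes. -/
theorem besselJ0_add_latticeSum {α k : ℝ} (hk : 0 < k) (hβ : ∀ j : ℤ, betaMode α k j ≠ 0)
    (z y : Plane) :
    (besselJ0 (k * ‖z - y‖) : ℂ) + latticeSum α k z y
      = ∑ j ∈ (propagating_finite α k).toFinset,
        (Real.pi : ℂ)⁻¹ * waveDensity k (z 0 - y 0) (z 1 - y 1) (alphaMode α j) := by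
  rw [latticeSum, (hasSum_latticeTerm hk hβ z y).tsum_eq]
  ring

/-! ### The Helmholtz equation on a period cell -/

theorem shift_zero_apply (x : Plane) (t : ℝ) : shift x t 0 = x 0 + t := rfl

theorem shift_one_apply (x : Plane) (t : ℝ) : shift x t 1 = x 1 := rfl

theorem shift_eq_add (x : Plane) (t : ℝ) : shift x t = x + !₂[t, 0] := by
  ext i; fin_cases i <;> simp [shift]

theorem hasCompactSupport_mul_coord {a b : ℝ → ℂ} (ha : HasCompactSupport a)
    (hb : HasCompactSupport b) : HasCompactSupport fun x : Plane => a (x 0) * b (x 1) := by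
  have hK : IsCompact ((fun p : ℝ × ℝ => (!₂[p.1, p.2] : Plane)) '' (tsupport a ×ˢ tsupport b)) := by
    refine (ha.isCompact.prod hb.isCompact).image ?_
    refine (PiLp.continuous_toLp 2 _).comp (continuous_pi fun i => ?_)
    fin_cases i
    · exact continuous_fst
    · exact continuous_snd
  refine HasCompactSupport.intro hK fun x hx => ?_
  by_contra hne
  refine hx ⟨(x 0, x 1), ⟨subset_tsupport _ (left_ne_zero_of_mul hne),
    subset_tsupport _ (right_ne_zero_of_mul hne)⟩, ?_⟩
  ext i; fin_cases i <;> rfl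

theorem measurableSet_cell : MeasurableSet cell :=
  (measurableSet_Ioo (a := -Real.pi) (b := Real.pi)).preimage
    (by fun_prop : Measurable fun x : Plane => x 0)

theorem integrable_mul_coord {P : Plane → ℂ} (hP : LocallyIntegrable P) {a b : ℝ → ℂ}
    (hac : Continuous a) (ha : HasCompactSupport a) (hbc : Continuous b)
    (hb : HasCompactSupport b) : Integrable fun x : Plane => P x * (a (x 0) * b (x 1)) := by
  have := hP.integrable_smul_right_of_hasCompactSupport
    (by fun_prop : Continuous fun x : Plane => a (x 0) * b (x 1)) (hasCompactSupport_mul_coord ha hb)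
  simpa only [smul_eq_mul] using this

theorem volume_vertical_line (a : ℝ) : volume {x : Plane | x 0 = a} = 0 := by
  have h := Measure.pi_hyperplane (fun _ : Fin 2 => (volume : Measure ℝ)) 0 a
  have hs : MeasurableSet {f : Fin 2 → ℝ | f 0 = a} :=
    measurableSet_eq_fun (by fun_prop) measurable_const
  have := (PiLp.volume_preserving_ofLp (Fin 2)).measure_preimage hs.nullMeasurableSet
  exact this.trans h

theorem cell_ae_eq : {x : Plane | x 0 ∈ Set.Ico (-Real.pi) Real.pi} =ᵐ[volume] cell := by
  have h : ∀ᵐ x : Plane, x 0 ≠ -Real.pi := by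
    rw [ae_iff]; simpa using volume_vertical_line (-Real.pi)
  filter_upwards [h] with x hx
  apply propext
  change (-Real.pi ≤ x 0 ∧ x 0 < Real.pi) ↔ (-Real.pi < x 0 ∧ x 0 < Real.pi)
  exact ⟨fun h => ⟨lt_of_le_of_ne h.1 (Ne.symm hx), h.2⟩, fun h => ⟨h.1.le, h.2⟩⟩

/-- The difference `S (u + a) - S (u - b)` of two translates. If `S` is a step, this is a window
that opens near `u = -a` and closes near `u = b`. -/
def window (S : ℝ → ℂ) (a b u : ℝ) : ℂ := S (u + a) - S (u - b)

/-- Unfolding of an integral over a period cell. The translates of `S (x₁ + π) - S (x₁ - π)` by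
multiples of `2π` telescope to the constant `c`; with `c = 1` they form a partition of unity, and
for the derivatives of `S` the constant is `0`. -/
theorem integral_mul_telescope {P : Plane → ℂ} (hP : LocallyIntegrable P)
    (hper : ∀ x, P (shift x (2 * Real.pi)) = P x) {S g : ℝ → ℂ} {c : ℂ} (hS : Continuous S)
    (hS0 : ∀ u < 0, S u = 0) (hS1 : ∀ u > 1, S u = c) (hg : Continuous g)
    (hgc : HasCompactSupport g) :
    ∫ x, P x * (window S Real.pi Real.pi (x 0) * g (x 1))
      = c * ∫ x in cell, P x * g (x 1) := by
  have hpi := Real.pi_gt_three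
  set θ : ℝ → ℂ := window S Real.pi Real.pi with hθ
  have hθc : Continuous θ := by unfold θ window; fun_prop
  have hθ0 : ∀ u, u ∉ Set.Ico (-Real.pi) (3 * Real.pi) → θ u = 0 := by
    intro u hu
    rcases lt_or_ge u (-Real.pi) with h | h
    · simp only [hθ, window, hS0 (u + Real.pi) (by linarith), hS0 (u - Real.pi) (by linarith), sub_self]
    · have h' : 3 * Real.pi ≤ u := by by_contra! hcon; exact hu ⟨h, hcon⟩
      simp only [hθ, window, hS1 (u + Real.pi) (by linarith), hS1 (u - Real.pi) (by linarith), sub_self]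
  have hθs : HasCompactSupport θ :=
    HasCompactSupport.intro (isCompact_Icc (a := -Real.pi) (b := 3 * Real.pi)) fun u hu =>
      hθ0 u fun h => hu (Set.Ico_subset_Icc_self h)
  set F : Plane → ℂ := fun x => P x * (θ (x 0) * g (x 1)) with hF
  have hFint : Integrable F := integrable_mul_coord hP hθc hθs hg hgc
  -- The window function is supported in two consecutive periods, and half-open strips are used so
  -- that they cover its support exactly.
  set A0 : Set Plane := {x | x 0 ∈ Set.Ico (-Real.pi) Real.pi} with hA0
  set A1 : Set Plane := {x | x 0 ∈ Set.Ico Real.pi (3 * Real.pi)} with hA1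
  have hm0 : MeasurableSet A0 := measurableSet_Ico.preimage (by fun_prop)
  have hm1 : MeasurableSet A1 := measurableSet_Ico.preimage (by fun_prop)
  have hdisj : Disjoint A0 A1 := by
    rw [Set.disjoint_left]
    intro x h0 h1
    exact absurd h0.2 (not_lt.2 h1.1)
  have hcompl : ∀ x ∉ A0 ∪ A1, F x = 0 := by
    intro x hx
    have : x 0 ∉ Set.Ico (-Real.pi) (3 * Real.pi) := by
      intro h
      rcases lt_or_ge (x 0) Real.pi with h' | h'
      · exact hx (Or.inl ⟨h.1, h'⟩)
      · exact hx (Or.inr ⟨h', h.2⟩)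
    simp only [hF, hθ0 _ this, zero_mul, mul_zero]
  have hFshift : Integrable fun x => F (shift x (2 * Real.pi)) := by
    simp_rw [shift_eq_add]
    exact hFint.comp_add_right _
  have hA1F : ∫ x in A1, F x = ∫ x in A0, F (shift x (2 * Real.pi)) := by
    rw [← integral_indicator hm1, ← integral_indicator hm0,
      ← integral_add_right_eq_self (A1.indicator F) (!₂[2 * Real.pi, 0] : Plane)]
    refine integral_congr_ae (Filter.Eventually.of_forall fun x => ?_)
    simp only [← shift_eq_add]
    have hiff : shift x (2 * Real.pi) ∈ A1 ↔ x ∈ A0 := by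
      simp only [hA0, hA1, Set.mem_ofPred_eq, shift_zero_apply, Set.mem_Ico]
      constructor <;> rintro ⟨h1, h2⟩ <;> constructor <;> linarith
    by_cases hx : x ∈ A0
    · rw [Set.indicator_of_mem hx, Set.indicator_of_mem (hiff.2 hx)]
    · rw [Set.indicator_of_notMem hx, Set.indicator_of_notMem (mt hiff.1 hx)]
  rw [← setIntegral_eq_integral_of_forall_compl_eq_zero hcompl,
    setIntegral_union hdisj hm1 hFint.integrableOn hFint.integrableOn, hA1F,
    ← integral_add hFint.integrableOn hFshift.integrableOn, ← setIntegral_congr_set cell_ae_eq,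
    ← integral_const_mul]
  refine setIntegral_congr_fun hm0 fun x hx => ?_
  have h1 : θ (x 0) + θ (x 0 + 2 * Real.pi) = c := by
    have hx' : -Real.pi ≤ x 0 ∧ x 0 < Real.pi := hx
    have e : x 0 + 2 * Real.pi - Real.pi = x 0 + Real.pi := by ring
    simp only [hθ, window, e, hS0 (x 0 - Real.pi) (by linarith),
      hS1 (x 0 + 2 * Real.pi + Real.pi) (by linarith)]
    ring
  simp only [hF, shift_zero_apply, shift_one_apply, hper]
  rw [← h1]
  ring

theorem fderiv_mul_coord {A B : ℝ → ℂ} (hA : Differentiable ℝ A) (hB : Differentiable ℝ B)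
    (x v : Plane) :
    fderiv ℝ (fun x : Plane => A (x 0) * B (x 1)) x v
      = v 0 * (deriv A (x 0) * B (x 1)) + v 1 * (A (x 0) * deriv B (x 1)) := by
  have h0 : HasFDerivAt (fun x : Plane => x 0) (EuclideanSpace.proj 0 : Plane →L[ℝ] ℝ) x :=
    (EuclideanSpace.proj 0 : Plane →L[ℝ] ℝ).hasFDerivAt
  have h1 : HasFDerivAt (fun x : Plane => x 1) (EuclideanSpace.proj 1 : Plane →L[ℝ] ℝ) x :=
    (EuclideanSpace.proj 1 : Plane →L[ℝ] ℝ).hasFDerivAt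
  have hA' := (hA (x 0)).hasDerivAt.hasFDerivAt.comp x h0
  have hB' := (hB (x 1)).hasDerivAt.hasFDerivAt.comp x h1
  have := (hA'.mul hB').fderiv
  simp only [Function.comp_def] at this
  rw [show (fun x : Plane => A (x 0) * B (x 1)) = (fun x => A (x.ofLp 0)) * fun x => B (x.ofLp 1) from rfl, this]
  simp
  ring

theorem laplacian_mul_coord {A B : ℝ → ℂ} (hA : ContDiff ℝ ∞ A) (hB : ContDiff ℝ ∞ B)
    (x : Plane) :
    (Δ fun x : Plane => A (x 0) * B (x 1)) x
      = deriv (deriv A) (x 0) * B (x 1) + A (x 0) * deriv (deriv B) (x 1) := by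
  have hA1 : ContDiff ℝ ∞ (deriv A) := (contDiff_infty_iff_deriv.1 hA).2
  have hB1 : ContDiff ℝ ∞ (deriv B) := (contDiff_infty_iff_deriv.1 hB).2
  have dA := hA.differentiable (by simp)
  have dB := hB.differentiable (by simp)
  have dA1 := hA1.differentiable (by simp)
  have dB1 := hB1.differentiable (by simp)
  have hf : ContDiff ℝ ∞ (fun x : Plane => A (x 0) * B (x 1)) := by fun_prop
  have key : ∀ v : Plane, iteratedFDeriv ℝ 2 (fun x : Plane => A (x 0) * B (x 1)) x ![v, v]
      = fderiv ℝ (fun y => fderiv ℝ (fun x : Plane => A (x 0) * B (x 1)) y v) x v := by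
    intro v
    rw [iteratedFDeriv_two_apply, fderiv_clm_apply
      ((hf.fderiv_right (m := ∞) (by simp)).differentiable (by simp) x) (differentiableAt_const _)]
    simp
  rw [InnerProductSpace.laplacian_eq_iteratedFDeriv_orthonormalBasis _
    (EuclideanSpace.basisFun (Fin 2) ℝ)]
  simp only [key, Fin.sum_univ_two, EuclideanSpace.basisFun_apply, fderiv_mul_coord dA dB]
  simp [fderiv_mul_coord dA1 dB, fderiv_mul_coord dA dB1]

theorem deriv_deriv_mul_exp {w : ℝ → ℂ} (hw : ContDiff ℝ ∞ w) (c : ℂ) (u : ℝ) :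
    deriv (deriv fun u : ℝ => w u * Complex.exp (c * u)) u
      = (deriv (deriv w) u + 2 * c * deriv w u + c ^ 2 * w u) * Complex.exp (c * u) := by
  have he : ∀ u : ℝ, HasDerivAt (fun u : ℝ => Complex.exp (c * u)) (c * Complex.exp (c * u)) u := by
    intro u
    have := ((Complex.ofRealCLM.hasDerivAt (x := u)).const_mul c).cexp
    simpa [mul_comm] using this
  have hw1 : ContDiff ℝ ∞ (deriv w) := (contDiff_infty_iff_deriv.1 hw).2
  have d0 := hw.differentiable (by simp)
  have d1 := hw1.differentiable (by simp)
  have h1 : (deriv fun u : ℝ => w u * Complex.exp (c * u))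
      = fun u : ℝ => (deriv w u + c * w u) * Complex.exp (c * u) := by
    funext u
    refine ((d0 u).hasDerivAt.mul (he u)).deriv.trans ?_
    ring
  rw [h1]
  refine (((d1 u).hasDerivAt.add ((d0 u).hasDerivAt.const_mul c)).mul (he u)).deriv.trans ?_
  simp only [Pi.add_apply]
  ring

/-- A smooth step from `0` on `u ≤ 0` to `1` on `u ≥ 1`. -/
def smoothStep (u : ℝ) : ℂ := Real.smoothTransition u

theorem contDiff_smoothStep : ContDiff ℝ ∞ smoothStep :=
  Complex.ofRealCLM.contDiff.comp Real.smoothTransition.contDiff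

theorem smoothStep_of_nonpos {u : ℝ} (hu : u ≤ 0) : smoothStep u = 0 := by
  simp [smoothStep, Real.smoothTransition.zero_of_nonpos hu]

theorem smoothStep_of_one_le {u : ℝ} (hu : 1 ≤ u) : smoothStep u = 1 := by
  simp [smoothStep, Real.smoothTransition.one_of_one_le hu]

theorem deriv_eventually_const {f : ℝ → ℂ} {U : Set ℝ} (hU : IsOpen U) {c : ℂ}
    (hf : ∀ u ∈ U, f u = c) : ∀ u ∈ U, deriv f u = 0 := by
  intro u hu
  have : f =ᶠ[nhds u] fun _ => c := Filter.eventuallyEq_of_mem (hU.mem_nhds hu) hf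
  rw [this.deriv_eq, deriv_const]

theorem deriv_smoothStep {u : ℝ} (hu : u < 0 ∨ 1 < u) : deriv smoothStep u = 0 := by
  rcases hu with hu | hu
  · exact deriv_eventually_const isOpen_Iio (fun v hv => smoothStep_of_nonpos (le_of_lt hv)) u hu
  · exact deriv_eventually_const isOpen_Ioi (fun v hv => smoothStep_of_one_le (le_of_lt hv)) u hu

theorem deriv_deriv_smoothStep {u : ℝ} (hu : u < 0 ∨ 1 < u) : deriv (deriv smoothStep) u = 0 := by
  rcases hu with hu | hu
  · exact deriv_eventually_const isOpen_Iio (fun v hv => deriv_smoothStep (Or.inl hv)) u hu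
  · exact deriv_eventually_const isOpen_Ioi (fun v hv => deriv_smoothStep (Or.inr hv)) u hu

theorem contDiff_window {S : ℝ → ℂ} (hS : ContDiff ℝ ∞ S) (a b : ℝ) :
    ContDiff ℝ ∞ (window S a b) :=
  (hS.comp (contDiff_id.add contDiff_const)).sub (hS.comp (contDiff_id.sub contDiff_const))

theorem deriv_window {S : ℝ → ℂ} (hS : ContDiff ℝ ∞ S) (a b : ℝ) :
    deriv (window S a b) = window (deriv S) a b := by
  funext u
  have hd := hS.differentiable (by simp)
  have h1 := (hd (u + a)).hasDerivAt.comp_add_const u a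
  have h2 := (hd (u - b)).hasDerivAt.comp_sub_const u b
  exact (h1.sub h2).deriv

theorem deriv_deriv_window {S : ℝ → ℂ} (hS : ContDiff ℝ ∞ S) (a b : ℝ) :
    deriv (deriv (window S a b)) = window (deriv (deriv S)) a b := by
  rw [deriv_window hS, deriv_window (contDiff_infty_iff_deriv.1 hS).2]

theorem hasCompactSupport_window (a b : ℝ) : HasCompactSupport (window smoothStep a b) := by
  refine HasCompactSupport.intro (isCompact_Icc (a := min (-a) b) (b := max (1 - a) (1 + b)))
    fun u hu => ?_
  simp only [Set.mem_Icc, not_and_or, not_le, lt_min_iff, max_lt_iff] at hu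
  rcases hu with ⟨h1, h2⟩ | ⟨h1, h2⟩
  · rw [window, smoothStep_of_nonpos (by linarith), smoothStep_of_nonpos (by linarith), sub_self]
  · rw [window, smoothStep_of_one_le (by linarith), smoothStep_of_one_le (by linarith), sub_self]

theorem locallyIntegrable_mul_exp {v : Plane → ℂ} (hv : LocallyIntegrable v) (c : ℂ) :
    LocallyIntegrable fun x : Plane => v x * Complex.exp (c * x 0) :=
  hv.mul_continuous (by fun_prop)

/-- Testing the Helmholtz equation on a period cell: if `a² + b² = k²`, the plane wave
`e^{-iax₁-ibx₂}`, cut off in the vertical direction by `χ`, is paired with both sides of the equation.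
On the plane the test function is cut off in the horizontal direction by a partition of unity, which
is then summed over the periods. -/
theorem integral_cell_of_isHelmholtzSolution {k a : ℝ} {b : ℂ} (hab : (a : ℂ) ^ 2 + b ^ 2 = k ^ 2)
    {v f : Plane → ℂ} (hv : LocallyIntegrable v) (hf : LocallyIntegrable f)
    (hsol : IsHelmholtzSolution k v f)
    (hvper : ∀ x, v (shift x (2 * Real.pi)) = Complex.exp (Complex.I * a * (2 * Real.pi)) * v x)
    (hfper : ∀ x, f (shift x (2 * Real.pi)) = Complex.exp (Complex.I * a * (2 * Real.pi)) * f x)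
    {χ : ℝ → ℂ} (hχ : ContDiff ℝ ∞ χ) (hχc : HasCompactSupport χ) :
    ∫ x in cell, v x * Complex.exp (-Complex.I * a * x 0) *
        ((deriv (deriv χ) (x 1) + 2 * (-Complex.I * b) * deriv χ (x 1)) *
          Complex.exp (-Complex.I * b * x 1))
      = ∫ x in cell, f x * Complex.exp (-Complex.I * a * x 0) *
          (χ (x 1) * Complex.exp (-Complex.I * b * x 1)) := by
  set θ : ℝ → ℂ := window smoothStep Real.pi Real.pi with hθ
  set A : ℝ → ℂ := fun u => θ u * Complex.exp (-Complex.I * a * u) with hA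
  set B : ℝ → ℂ := fun t => χ t * Complex.exp (-Complex.I * b * t) with hB
  set G : ℝ → ℂ := fun t => (deriv (deriv χ) t + 2 * (-Complex.I * b) * deriv χ t) *
          Complex.exp (-Complex.I * b * t) with hG
  have hexp : ∀ c : ℂ, ContDiff ℝ ∞ fun u : ℝ => Complex.exp (c * u) := fun c =>
    (contDiff_const.mul Complex.ofRealCLM.contDiff).cexp
  have hθs : ContDiff ℝ ∞ θ := contDiff_window contDiff_smoothStep _ _
  have hθc : HasCompactSupport θ := hasCompactSupport_window _ _
  have hAs : ContDiff ℝ ∞ A := hθs.mul (hexp _)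
  have hBs : ContDiff ℝ ∞ B := hχ.mul (hexp _)
  have hAc : HasCompactSupport A := hθc.mul_right
  have hBc : HasCompactSupport B := hχc.mul_right
  have hχ1 : ContDiff ℝ ∞ (deriv χ) := (contDiff_infty_iff_deriv.1 hχ).2
  have hχ2 : ContDiff ℝ ∞ (deriv (deriv χ)) := (contDiff_infty_iff_deriv.1 hχ1).2
  have hGs : Continuous G :=
    ((hχ2.continuous.add (continuous_const.mul hχ1.continuous)).mul (hexp _).continuous)
  have hGc : HasCompactSupport G :=
    (hχc.deriv.deriv.add hχc.deriv.mul_left).mul_right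
  have hs0 := contDiff_smoothStep
  have hs1 := (contDiff_infty_iff_deriv.1 hs0).2
  have hs2 := (contDiff_infty_iff_deriv.1 hs1).2
  have hper : ∀ w : Plane → ℂ,
      (∀ x, w (shift x (2 * Real.pi)) = Complex.exp (Complex.I * a * (2 * Real.pi)) * w x) →
      ∀ x, w (shift x (2 * Real.pi)) * Complex.exp (-Complex.I * a * (shift x (2 * Real.pi)) 0)
        = w x * Complex.exp (-Complex.I * a * x 0) := by
    intro w hw x
    rw [hw, mul_comm _ (w x), mul_assoc, ← Complex.exp_add, shift_zero_apply]
    congr 2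
    push_cast; ring
  have hPv := locallyIntegrable_mul_exp hv (-Complex.I * a)
  have hPf := locallyIntegrable_mul_exp hf (-Complex.I * a)
  have htest := hsol (fun x => A (x 0) * B (x 1)) (by fun_prop) (hasCompactSupport_mul_coord hAc hBc)
  have hR := integral_mul_telescope hPf (hper f hfper) (S := smoothStep) (c := 1) (g := B)
    hs0.continuous (fun u hu => smoothStep_of_nonpos hu.le) (fun u hu => smoothStep_of_one_le hu.le)
    hBs.continuous hBc
  have hL1 := integral_mul_telescope hPv (hper v hvper) (S := smoothStep) (c := 1) (g := G)
    hs0.continuous (fun u hu => smoothStep_of_nonpos hu.le) (fun u hu => smoothStep_of_one_le hu.le)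
    hGs hGc
  have hL2 := integral_mul_telescope hPv (hper v hvper)
    (S := fun u => deriv (deriv smoothStep) u + 2 * (-Complex.I * a) * deriv smoothStep u)
    (c := 0) (g := B) (hs2.continuous.add (continuous_const.mul hs1.continuous))
    (fun u hu => by simp [deriv_smoothStep (Or.inl hu), deriv_deriv_smoothStep (Or.inl hu)])
    (fun u hu => by simp [deriv_smoothStep (Or.inr hu), deriv_deriv_smoothStep (Or.inr hu)])
    hBs.continuous hBc
  -- The terms of `Δ` that differentiate the horizontal cutoff again form a window, of step height `0`.
  have hS2 : window (fun u => deriv (deriv smoothStep) u + 2 * (-Complex.I * a) * deriv smoothStep u)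
      Real.pi Real.pi = fun u => deriv (deriv θ) u + 2 * (-Complex.I * a) * deriv θ u := by
    funext u
    rw [hθ, deriv_deriv_window hs0, deriv_window hs0]
    simp only [window]
    ring
  rw [one_mul, ← hθ] at hR hL1
  rw [zero_mul] at hL2
  rw [← hL1, ← hR, ← add_zero (∫ x : Plane, _), ← hL2, ← integral_add]
  · refine Eq.trans ?_ (htest.trans ?_)
    · refine integral_congr_ae (Filter.Eventually.of_forall fun x => ?_)
      simp only [laplacian_mul_coord hAs hBs]
      rw [hA, deriv_deriv_mul_exp hθs, hB, deriv_deriv_mul_exp hχ, ← hab, hS2]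
      simp only [hG]
      generalize Complex.exp (-Complex.I * a * x 0) = E
      generalize Complex.exp (-Complex.I * b * x 1) = E'
      generalize θ (x 0) = w, v x = V, χ (x 1) = y
      linear_combination (-V * E * w * E' * y * (a ^ 2 + b ^ 2)) * Complex.I_sq
    · refine integral_congr_ae (Filter.Eventually.of_forall fun x => ?_)
      simp only [hA]
      ring
  · exact integrable_mul_coord hPv hθs.continuous hθc hGs hGc
  · refine integrable_mul_coord hPv ?_ ?_ hBs.continuous hBc
    · rw [hS2]
      have h1 := (contDiff_infty_iff_deriv.1 hθs).2
      have h2 := (contDiff_infty_iff_deriv.1 h1).2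
      exact h2.continuous.add (continuous_const.mul h1.continuous)
    · rw [hS2]
      exact hθc.deriv.deriv.add hθc.deriv.mul_left

/-! ### Fields with a Rayleigh expansion -/

/-- Fubini's theorem on a period cell. -/
theorem integral_cell_eq {F : Plane → ℂ} (hF : IntegrableOn F cell) :
    ∫ x in cell, F x = ∫ t : ℝ, ∫ u in Set.Ioo (-Real.pi) Real.pi, F !₂[u, t] := by
  set e : ℝ × ℝ ≃ᵐ Plane :=
    (MeasurableEquiv.finTwoArrow (α := ℝ)).symm.trans (MeasurableEquiv.toLp 2 (Fin 2 → ℝ)) with he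
  have hmp : MeasurePreserving e :=
    (PiLp.volume_preserving_toLp (Fin 2)).comp (volume_preserving_finTwoArrow ℝ).symm
  have hee : ∀ p : ℝ × ℝ, e p = !₂[p.1, p.2] := fun p => rfl
  have hpre : e ⁻¹' cell = Set.Ioo (-Real.pi) Real.pi ×ˢ Set.univ := by
    ext p
    simp [hee, cell]
  have hint := (hmp.integrableOn_comp_preimage e.measurableEmbedding).2 hF
  rw [← hmp.setIntegral_preimage_emb e.measurableEmbedding, hpre]
  rw [hpre] at hint
  have hμ : (volume : Measure (ℝ × ℝ)).restrict (Set.Ioo (-Real.pi) Real.pi ×ˢ Set.univ)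
      = (volume.restrict (Set.Ioo (-Real.pi) Real.pi)).prod volume := by
    rw [Measure.volume_eq_prod, ← Measure.prod_restrict, Measure.restrict_univ]
  rw [IntegrableOn, hμ] at hint
  rw [hμ, show (∫ x, F (e x) ∂((volume.restrict (Set.Ioo (-Real.pi) Real.pi)).prod volume))
    = ∫ x, (F ∘ e) x ∂((volume.restrict (Set.Ioo (-Real.pi) Real.pi)).prod volume) from rfl,
    integral_prod_symm _ hint]
  rfl

theorem integral_exp_int (m : ℤ) :
    ∫ u in (-Real.pi)..Real.pi, Complex.exp (Complex.I * (m * u : ℝ))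
      = if m = 0 then (2 * Real.pi : ℂ) else 0 := by
  split_ifs with hm
  · subst hm
    simp; ring
  · have hc : (Complex.I * m : ℂ) ≠ 0 := by simp [hm]
    have : ∀ u : ℝ, Complex.exp (Complex.I * (m * u : ℝ)) = Complex.exp (Complex.I * m * u) :=
      fun u => by congr 1; push_cast; ring
    simp_rw [this]
    rw [integral_exp_mul_complex hc, div_eq_zero_iff]
    left
    rw [sub_eq_zero, Complex.exp_eq_exp_iff_exists_int]
    exact ⟨m, by push_cast; ring⟩

/-- The coefficients of a pointwise convergent series `∑ c_j e^{iα_j u}` are Fourier coefficients: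
convergence at one point is absolute convergence, and hence uniform in `u`. -/
theorem integral_mul_exp_of_hasSum {α : ℝ} {c : ℤ → ℂ} {V : ℝ → ℂ}
    (hV : ∀ u : ℝ, HasSum (fun m : ℤ => c m * Complex.exp (Complex.I * alphaMode α m * u)) (V u))
    (j : ℤ) :
    ∫ u in Set.Ioo (-Real.pi) Real.pi, V u * Complex.exp (-Complex.I * alphaMode α j * u)
      = 2 * Real.pi * c j := by
  rw [← integral_Ioc_eq_integral_Ioo,
    ← intervalIntegral.integral_of_le (by linarith [Real.pi_pos])]
  have hterm : ∀ (m : ℤ) (u : ℝ), c m * Complex.exp (Complex.I * alphaMode α m * u) *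
      Complex.exp (-Complex.I * alphaMode α j * u)
      = c m * Complex.exp (Complex.I * (((m - j : ℤ) : ℝ) * u : ℝ)) := by
    intro m u
    rw [mul_assoc, ← Complex.exp_add]
    congr 2
    simp only [alphaMode]
    push_cast; ring
  have hsum : Summable fun m => ‖c m‖ := by
    have := (hV 0).summable.norm
    simpa using this
  have h := intervalIntegral.hasSum_integral_of_dominated_convergence
    (μ := volume) (a := -Real.pi) (b := Real.pi)
    (F := fun (m : ℤ) u => c m * Complex.exp (Complex.I * (((m - j : ℤ) : ℝ) * u : ℝ)))
    (f := fun u => V u * Complex.exp (-Complex.I * alphaMode α j * u))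
    (fun m _ => ‖c m‖) (fun m => (by fun_prop : Continuous fun u : ℝ =>
        c m * Complex.exp (Complex.I * (((m - j : ℤ) : ℝ) * u : ℝ))).aestronglyMeasurable)
    (fun m => Filter.Eventually.of_forall fun u _ => by
      rw [norm_mul, mul_comm Complex.I, Complex.norm_exp_ofReal_mul_I, mul_one])
    (Filter.Eventually.of_forall fun _ _ => hsum) intervalIntegrable_const
    (Filter.Eventually.of_forall fun u _ => by
      simpa only [hterm] using (hV u).mul_right (Complex.exp (-Complex.I * alphaMode α j * u)))
  simp_rw [intervalIntegral.integral_const_mul, integral_exp_int, sub_eq_zero, mul_ite, mul_zero] at h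
  rw [h.unique (hasSum_ite_eq j (c j * (2 * Real.pi)) |>.congr_fun fun m => by
    by_cases hm : m = j
    · subst hm; simp
    · simp [hm])]
  ring

theorem hasCompactSupport_deriv_smoothStep : HasCompactSupport (deriv smoothStep) := by
  refine HasCompactSupport.intro (isCompact_Icc (a := (0 : ℝ)) (b := 1)) fun u hu => ?_
  refine deriv_smoothStep ?_
  by_contra! h
  exact hu ⟨h.1, h.2⟩

theorem tendsto_zero_of_hasCompactSupport {f : ℝ → ℂ} (hf : HasCompactSupport f) :
    Filter.Tendsto f Filter.atBot (nhds 0) ∧ Filter.Tendsto f Filter.atTop (nhds 0) := by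
  have := hf.is_zero_at_infty
  exact ⟨this.mono_left atBot_le_cocompact, this.mono_left atTop_le_cocompact⟩

theorem continuous_deriv_smoothStep : Continuous (deriv smoothStep) :=
  (contDiff_infty_iff_deriv.1 contDiff_smoothStep).2.continuous

theorem continuous_deriv_deriv_smoothStep : Continuous (deriv (deriv smoothStep)) :=
  (contDiff_infty_iff_deriv.1 (contDiff_infty_iff_deriv.1 contDiff_smoothStep).2).2.continuous

theorem integrable_smoothStep_mul_exp (c d : ℂ) : Integrable fun t : ℝ =>
    (deriv (deriv smoothStep) t + c * deriv smoothStep t) * Complex.exp (d * t) := by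
  have h1 := continuous_deriv_smoothStep
  have h2 := continuous_deriv_deriv_smoothStep
  refine Continuous.integrable_of_hasCompactSupport (by fun_prop) ?_
  exact (hasCompactSupport_deriv_smoothStep.deriv.add
    hasCompactSupport_deriv_smoothStep.mul_left).mul_right

/-- The resonant case `c = d` of the boundary integral: the integrand is the derivative of
`smoothStep' e^{ct}`. -/
theorem integral_smoothStep_mul_exp (c : ℂ) :
    ∫ t : ℝ, (deriv (deriv smoothStep) t + c * deriv smoothStep t) * Complex.exp (c * t) = 0 := by
  have hc : HasCompactSupport fun t : ℝ => deriv smoothStep t * Complex.exp (c * t) :=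
    hasCompactSupport_deriv_smoothStep.mul_right
  have hd := (contDiff_infty_iff_deriv.1 contDiff_smoothStep).2.differentiable (by simp)
  have h : ∀ t : ℝ, HasDerivAt (fun t : ℝ => deriv smoothStep t * Complex.exp (c * t))
      ((deriv (deriv smoothStep) t + c * deriv smoothStep t) * Complex.exp (c * t)) t := by
    intro t
    have he := ((Complex.ofRealCLM.hasDerivAt (x := t)).const_mul c).cexp
    refine ((hd t).hasDerivAt.mul he).congr_deriv ?_
    simp only [Complex.ofRealCLM_apply, Complex.ofReal_one]
    ring
  rw [integral_of_hasDerivAt_of_tendsto h (integrable_smoothStep_mul_exp c c)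
    (tendsto_zero_of_hasCompactSupport hc).1 (tendsto_zero_of_hasCompactSupport hc).2, sub_zero]

theorem integral_deriv_deriv_smoothStep_add (c : ℂ) :
    ∫ t : ℝ, (deriv (deriv smoothStep) t + c * deriv smoothStep t) = c := by
  have hs1 := continuous_deriv_smoothStep.integrable_of_hasCompactSupport
    hasCompactSupport_deriv_smoothStep (μ := volume)
  have hs2 := continuous_deriv_deriv_smoothStep.integrable_of_hasCompactSupport
    hasCompactSupport_deriv_smoothStep.deriv (μ := volume)
  have h2 : ∫ t : ℝ, deriv (deriv smoothStep) t = 0 := by simpa using integral_smoothStep_mul_exp 0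
  have h1 : ∫ t : ℝ, deriv smoothStep t = 1 := by
    rw [integral_of_hasDerivAt_of_tendsto
      (fun t => (contDiff_smoothStep.differentiable (by simp) t).hasDerivAt) hs1
      (m := 0) (n := 1), sub_zero]
    · refine tendsto_const_nhds.congr' ?_
      filter_upwards [Filter.eventually_le_atBot 0] with t ht
      exact (smoothStep_of_nonpos ht).symm
    · refine tendsto_const_nhds.congr' ?_
      filter_upwards [Filter.eventually_ge_atTop 1] with t ht
      exact (smoothStep_of_one_le ht).symm
  rw [integral_add hs2 (hs1.const_mul c), integral_const_mul, h1, h2]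
  ring

/-- The left-hand side of the tested equation, for `χ` with transition layers `[-h-1, -h]` and
`[h, h+1]`, only sees the field where its Rayleigh expansion is valid. -/
theorem integral_cell_rayleigh {α k h : ℝ} (hh : 0 < h) {v : Plane → ℂ} (hv : LocallyIntegrable v)
    {up um : ℤ → ℂ} (hR : HasRayleighExpansion α k h v up um) (j : ℤ) (b : ℂ) :
    ∫ x in cell, v x * Complex.exp (-Complex.I * alphaMode α j * x 0) *
        ((deriv (deriv (window smoothStep (h + 1) h)) (x 1)
            + 2 * (-Complex.I * b) * deriv (window smoothStep (h + 1) h) (x 1)) *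
          Complex.exp (-Complex.I * b * x 1))
      = 2 * Real.pi * um j * Complex.exp (Complex.I * betaMode α k j + Complex.I * b * (h + 1)) *
          (∫ t : ℝ, (deriv (deriv smoothStep) t + 2 * (-Complex.I * b) * deriv smoothStep t) *
            Complex.exp (-Complex.I * (betaMode α k j + b) * t))
        - 2 * Real.pi * up j * Complex.exp (-Complex.I * b * h) *
          (∫ t : ℝ, (deriv (deriv smoothStep) t + 2 * (-Complex.I * b) * deriv smoothStep t) *
            Complex.exp (Complex.I * (betaMode α k j - b) * t)) := by
  set β := betaMode α k j with hβ
  set s : ℝ → ℂ := fun t => deriv (deriv smoothStep) t + 2 * (-Complex.I * b) * deriv smoothStep t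
    with hs
  have hs0 : ∀ t, (t < 0 ∨ 1 < t) → s t = 0 := fun t ht => by
    simp only [hs, deriv_deriv_smoothStep ht, deriv_smoothStep ht, mul_zero, add_zero]
  have hsc : Continuous s := continuous_deriv_deriv_smoothStep.add
    (continuous_const.mul continuous_deriv_smoothStep)
  have hss : HasCompactSupport s := hasCompactSupport_deriv_smoothStep.deriv.add
    hasCompactSupport_deriv_smoothStep.mul_left
  set G : ℝ → ℂ := fun t => (s (t + (h + 1)) - s (t - h)) * Complex.exp (-Complex.I * b * t) with hG
  have hGs : HasCompactSupport G :=
    ((hss.comp_homeomorph (Homeomorph.addRight (h + 1))).sub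
      (hss.comp_homeomorph (Homeomorph.subRight h))).mul_right
  have hGc : Continuous G := by fun_prop
  have hwin : ∀ t : ℝ, (deriv (deriv (window smoothStep (h + 1) h)) t
      + 2 * (-Complex.I * b) * deriv (window smoothStep (h + 1) h) t) *
          Complex.exp (-Complex.I * b * t) = G t := by
    intro t
    rw [deriv_deriv_window contDiff_smoothStep, deriv_window contDiff_smoothStep]
    simp only [window, hG, hs]
    ring
  simp only [hwin]
  have hint : IntegrableOn (fun x : Plane => v x *
      Complex.exp (-Complex.I * alphaMode α j * x 0) * G (x 1)) cell := by
    have h1 := integrable_mul_coord (locallyIntegrable_mul_exp hv (-Complex.I * alphaMode α j))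
      (contDiff_window contDiff_smoothStep (Real.pi + 1) Real.pi).continuous
      (hasCompactSupport_window _ _) hGc hGs
    refine (h1.integrableOn (s := cell)).congr_fun (fun x hx => ?_) measurableSet_cell
    have hx' : -Real.pi < x 0 ∧ x 0 < Real.pi := hx
    simp only [window, smoothStep_of_one_le (u := x 0 + (Real.pi + 1)) (by linarith),
      smoothStep_of_nonpos (u := x 0 - Real.pi) (by linarith), sub_zero, one_mul]
  rw [integral_cell_eq hint]
  -- Both terms on the right may be written for all `t`: each vanishes outside its own layer.
  have hinner : ∀ t : ℝ, ∫ u in Set.Ioo (-Real.pi) Real.pi, v !₂[u, t] *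
      Complex.exp (-Complex.I * alphaMode α j * (!₂[u, t] : Plane) 0) * G ((!₂[u, t] : Plane) 1)
      = 2 * Real.pi * um j * Complex.exp (-Complex.I * β * (t + h)) *
          (s (t + (h + 1)) * Complex.exp (-Complex.I * b * t))
        - 2 * Real.pi * up j * Complex.exp (Complex.I * β * (t - h)) *
          (s (t - h) * Complex.exp (-Complex.I * b * t)) := by
    intro t
    simp only [Matrix.cons_val_zero, Matrix.cons_val_one]
    rw [integral_mul_const]
    rcases le_or_gt h t with ht | ht
    · have hc := integral_mul_exp_of_hasSum (α := α) (V := fun u => v !₂[u, t])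
        (c := fun m => up m * Complex.exp (Complex.I * betaMode α k m * (t - h))) (fun u => by
          refine (hR.above !₂[u, t] ht).congr_fun fun m => ?_
          rw [mul_assoc, ← Complex.exp_add]
          simp only [Matrix.cons_val_zero, Matrix.cons_val_one]
          congr 2
          ring) j
      simp only [hc, ← hβ, hG, hs0 (t + (h + 1)) (Or.inr (by linarith))]
      ring
    rcases le_or_gt t (-h) with ht' | ht'
    · have hc := integral_mul_exp_of_hasSum (α := α) (V := fun u => v !₂[u, t])
        (c := fun m => um m * Complex.exp (-Complex.I * betaMode α k m * (t + h))) (fun u => by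
          refine (hR.below !₂[u, t] ht').congr_fun fun m => ?_
          rw [mul_assoc, ← Complex.exp_add]
          simp only [Matrix.cons_val_zero, Matrix.cons_val_one]
          congr 2
          ring) j
      simp only [hc, ← hβ, hG, hs0 (t - h) (Or.inl (by linarith))]
      ring
    · simp only [hG, hs0 (t + (h + 1)) (Or.inr (by linarith)), hs0 (t - h) (Or.inl (by linarith))]
      ring
  simp_rw [hinner]
  have hm : ∀ t : ℝ, 2 * Real.pi * um j * Complex.exp (-Complex.I * β * (t + h)) *
          (s (t + (h + 1)) * Complex.exp (-Complex.I * b * t))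
      = (fun t : ℝ => 2 * Real.pi * um j * Complex.exp (Complex.I * β + Complex.I * b * (h + 1)) *
          (s t * Complex.exp (-Complex.I * (β + b) * t))) (t + (h + 1)) := by
    intro t
    have : Complex.exp (-Complex.I * β * (t + h)) * Complex.exp (-Complex.I * b * t)
        = Complex.exp (Complex.I * β + Complex.I * b * (h + 1)) *
          Complex.exp (-Complex.I * (β + b) * (t + (h + 1) : ℝ)) := by
      rw [← Complex.exp_add, ← Complex.exp_add]
      congr 1
      push_cast; ring
    linear_combination (2 * Real.pi * um j * s (t + (h + 1))) * this
  have hp : ∀ t : ℝ, 2 * Real.pi * up j * Complex.exp (Complex.I * β * (t - h)) *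
          (s (t - h) * Complex.exp (-Complex.I * b * t))
      = (fun t : ℝ => 2 * Real.pi * up j * Complex.exp (-Complex.I * b * h) *
          (s t * Complex.exp (Complex.I * (β - b) * t))) (t - h) := by
    intro t
    have : Complex.exp (Complex.I * β * (t - h)) * Complex.exp (-Complex.I * b * t)
        = Complex.exp (-Complex.I * b * h) *
          Complex.exp (Complex.I * (β - b) * (t - h : ℝ)) := by
      rw [← Complex.exp_add, ← Complex.exp_add]
      congr 1
      push_cast; ring
    linear_combination (2 * Real.pi * up j * s (t - h)) * this
  have im := (integrable_smoothStep_mul_exp (2 * (-Complex.I * b)) (-Complex.I * (β + b))).const_mul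
    (2 * Real.pi * um j * Complex.exp (Complex.I * β + Complex.I * b * (h + 1)))
  have ip := (integrable_smoothStep_mul_exp (2 * (-Complex.I * b)) (Complex.I * (β - b))).const_mul
    (2 * Real.pi * up j * Complex.exp (-Complex.I * b * h))
  simp_rw [hm, hp]
  rw [integral_sub (im.comp_add_right (h + 1)) (ip.comp_sub_right h),
    integral_add_right_eq_self (fun t : ℝ => 2 * Real.pi * um j *
      Complex.exp (Complex.I * β + Complex.I * b * (h + 1)) *
          (s t * Complex.exp (-Complex.I * (β + b) * t))) (h + 1),
    integral_sub_right_eq_self (fun t : ℝ => 2 * Real.pi * up j * Complex.exp (-Complex.I * b * h) *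
          (s t * Complex.exp (Complex.I * (β - b) * t))) h,
    integral_const_mul, integral_const_mul]

/-! ### Rayleigh coefficients and the indicator function -/

theorem contrast_shift {n : Plane → ℂ} {h : ℝ} (hn : IsMedium n h) (x : Plane) :
    contrast n (shift x (2 * Real.pi)) = contrast n x := by
  rw [contrast, hn.periodic, contrast]

theorem locallyIntegrable_contrast_mul {n u : Plane → ℂ} {h : ℝ} (hn : IsMedium n h)
    (hu : LocallyIntegrable u) : LocallyIntegrable fun x => contrast n x * u x := by
  obtain ⟨C, hC⟩ := hn.bounded
  intro x
  obtain ⟨U, hU, hint⟩ := hu x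
  refine ⟨U, hU, Integrable.bdd_mul (c := C + 1) hint ?_ ?_⟩
  · exact (hn.measurable.sub_const 1).aestronglyMeasurable
  · refine Filter.Eventually.of_forall fun y => (norm_sub_le _ _).trans ?_
    simpa using hC y

theorem measurableSet_scatterer (n : Plane → ℂ) : MeasurableSet (scatterer n) :=
  (isClosed_tsupport _).measurableSet.inter measurableSet_cell

theorem integrableOn_scatterer {n u : Plane → ℂ} {h : ℝ} (hn : IsMedium n h)
    (hu : LocallyIntegrable u) {w : Plane → ℂ} (hw : Continuous w) :
    IntegrableOn (fun y => w y * contrast n y * u y) (scatterer n) := by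
  obtain ⟨c, -, hc⟩ := hn.lt_height
  have hK : IsCompact (Metric.closedBall (0 : Plane) (Real.sqrt (Real.pi ^ 2 + c ^ 2))) :=
    isCompact_closedBall _ _
  have hli : LocallyIntegrable fun y => w y * (contrast n y * u y) :=
    (locallyIntegrable_contrast_mul hn hu).continuous_mul hw
  simp_rw [mul_assoc]
  refine (hli.integrableOn_isCompact hK).mono_set fun y hy => ?_
  have h0 : -Real.pi < y 0 ∧ y 0 < Real.pi := hy.2
  have h1 := hc y hy
  rw [mem_closedBall_zero_iff, EuclideanSpace.norm_eq, Fin.sum_univ_two]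
  refine Real.sqrt_le_sqrt (add_le_add ?_ ?_)
  · rw [Real.norm_eq_abs]
    exact pow_le_pow_left₀ (abs_nonneg _) (abs_le.2 ⟨h0.1.le, h0.2.le⟩) 2
  · rw [Real.norm_eq_abs]
    exact pow_le_pow_left₀ (abs_nonneg _) h1 2

/-- The tested equation for a scattered field. The right-hand side is the integral of the source
`q u` against the plane wave `e^{-iα_j x₁ - ibx₂}`, without a cutoff: the cutoff is `1` on `D`. -/
theorem rayleigh_balance {α k h : ℝ} {n uin usc : Plane → ℂ} {up um : ℤ → ℂ} (hn : IsMedium n h)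
    (huin : LocallyIntegrable uin) (hq : IsQuasiperiodic α uin)
    (hs : IsScatteredField α k h n uin usc up um) (j : ℤ) {b : ℂ}
    (hb : (alphaMode α j : ℂ) ^ 2 + b ^ 2 = k ^ 2) :
    2 * Real.pi * um j * Complex.exp (Complex.I * betaMode α k j + Complex.I * b * (h + 1)) *
          (∫ t : ℝ, (deriv (deriv smoothStep) t + 2 * (-Complex.I * b) * deriv smoothStep t) *
            Complex.exp (-Complex.I * (betaMode α k j + b) * t))
        - 2 * Real.pi * up j * Complex.exp (-Complex.I * b * h) *
          (∫ t : ℝ, (deriv (deriv smoothStep) t + 2 * (-Complex.I * b) * deriv smoothStep t) *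
            Complex.exp (Complex.I * (betaMode α k j - b) * t))
      = -(k : ℂ) ^ 2 * ∫ y in scatterer n,
          Complex.exp (-Complex.I * alphaMode α j * y 0 - Complex.I * b * y 1) * contrast n y *
            (uin y + usc y) := by
  set f : Plane → ℂ := fun x => -(k : ℂ) ^ 2 * contrast n x * (uin x + usc x) with hf
  have hu : LocallyIntegrable fun x => uin x + usc x := huin.add hs.locallyIntegrable
  have hfi : LocallyIntegrable f := by
    have := (locallyIntegrable_contrast_mul hn hu).smul (-(k : ℂ) ^ 2)
    refine this.congr (Filter.Eventually.of_forall fun x => ?_)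
    simp only [hf, Pi.smul_apply, smul_eq_mul, mul_assoc]
  -- The phase factor of `α`-quasiperiodicity depends only on `α` modulo `1`.
  have hphase : Complex.exp (Complex.I * (2 * Real.pi * (1 : ℤ) * α))
      = Complex.exp (Complex.I * alphaMode α j * (2 * Real.pi)) := by
    rw [Complex.exp_eq_exp_iff_exists_int]
    exact ⟨-j, by simp only [alphaMode]; push_cast; ring⟩
  have hqp : ∀ w : Plane → ℂ, IsQuasiperiodic α w → ∀ x, w (shift x (2 * Real.pi))
      = Complex.exp (Complex.I * alphaMode α j * (2 * Real.pi)) * w x := by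
    intro w hw x
    have := hw 1 x
    rwa [hphase, Int.cast_one, mul_one] at this
  have hfper : ∀ x, f (shift x (2 * Real.pi))
      = Complex.exp (Complex.I * alphaMode α j * (2 * Real.pi)) * f x := by
    intro x
    simp only [hf, contrast_shift hn, hqp uin hq, hqp usc hs.quasiperiodic]
    ring
  have key := integral_cell_of_isHelmholtzSolution hb hs.locallyIntegrable hfi hs.helmholtz
    (hqp usc hs.quasiperiodic) hfper
    (contDiff_window contDiff_smoothStep (h + 1) h) (hasCompactSupport_window (h + 1) h)
  rw [integral_cell_rayleigh hn.height_pos hs.locallyIntegrable hs.rayleigh j b] at key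
  rw [key, ← integral_const_mul]
  have hsub : scatterer n ⊆ cell := Set.inter_subset_right
  refine (setIntegral_eq_of_subset_of_forall_sdiff_eq_zero measurableSet_cell hsub ?_).trans ?_
  · intro y hy
    have : contrast n y = 0 := image_eq_zero_of_notMem_tsupport fun h => hy.2 ⟨h, hy.1⟩
    simp [hf, this]
  · refine setIntegral_congr_fun (measurableSet_scatterer n) fun y hy => ?_
    obtain ⟨c, hc, hcy⟩ := hn.lt_height
    have h1 := abs_le.1 (hcy y hy)
    simp only [hf, window, smoothStep_of_one_le (u := y 1 + (h + 1)) (by linarith),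
      smoothStep_of_nonpos (u := y 1 - h) (by linarith), sub_zero, one_mul]
    rw [show -Complex.I * alphaMode α j * y 0 - Complex.I * b * y 1
      = -Complex.I * alphaMode α j * y 0 + -Complex.I * b * y 1 by ring, Complex.exp_add]
    ring

theorem propagating_sq_add {α k : ℝ} {j : ℤ} (hj : j ∈ propagating α k) :
    (alphaMode α j : ℂ) ^ 2 + betaMode α k j ^ 2 = k ^ 2 := by
  rw [betaMode_of_propagating hj, ← Complex.ofReal_pow (Real.sqrt _), Real.sq_sqrt
    (sub_nonneg.2 (mem_propagating_iff.1 hj).le)]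
  push_cast; ring

/-- The case `b = β_j` of `rayleigh_balance`: the lower layer contributes nothing, and the upper one
`4πiβ_j u_j⁺ e^{-iβ_j h}`. -/
theorem rayleigh_coeff_plus {α k h : ℝ} {n uin usc : Plane → ℂ} {up um : ℤ → ℂ} (hn : IsMedium n h)
    (huin : LocallyIntegrable uin) (hq : IsQuasiperiodic α uin)
    (hs : IsScatteredField α k h n uin usc up um) {j : ℤ} (hj : j ∈ propagating α k)
    (hβ : betaMode α k j ≠ 0) :
    up j = k ^ 2 * ∫ y in scatterer n, greenCoeffPlus α k h j y * contrast n y * (uin y + usc y) := by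
  have h1 := rayleigh_balance hn huin hq hs j (b := betaMode α k j) (propagating_sq_add hj)
  have h2 := integral_smoothStep_mul_exp (2 * (-Complex.I * betaMode α k j))
  have h3 := integral_deriv_deriv_smoothStep_add (2 * (-Complex.I * betaMode α k j))
  rw [show -Complex.I * (betaMode α k j + betaMode α k j) = 2 * (-Complex.I * betaMode α k j) by ring,
    h2] at h1
  simp only [sub_self, mul_zero, zero_mul, Complex.exp_zero, mul_one, h3] at h1
  have hpi : (Real.pi : ℂ) ≠ 0 := by exact_mod_cast Real.pi_ne_zero
  have hg : ∀ y : Plane, greenCoeffPlus α k h j y * contrast n y * (uin y + usc y)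
      = (Complex.I / (4 * Real.pi * betaMode α k j) * Complex.exp (Complex.I * betaMode α k j * h)) *
        (Complex.exp (-Complex.I * alphaMode α j * y 0 - Complex.I * betaMode α k j * y 1) *
          contrast n y * (uin y + usc y)) := by
    intro y
    rw [greenCoeffPlus, show -Complex.I * alphaMode α j * y 0 - Complex.I * betaMode α k j * (y 1 - h)
      = Complex.I * betaMode α k j * h +
        (-Complex.I * alphaMode α j * y 0 - Complex.I * betaMode α k j * y 1) by ring,
      Complex.exp_add]
    ring
  simp_rw [hg]
  rw [integral_const_mul]
  have hE : Complex.exp (Complex.I * betaMode α k j * h) *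
      Complex.exp (-Complex.I * betaMode α k j * h) = 1 := by
    rw [← Complex.exp_add]; simp
  rw [div_mul_eq_mul_div, div_mul_eq_mul_div, mul_div_assoc', eq_div_iff (by simp [hpi, hβ])]
  linear_combination (-Complex.I * Complex.exp (Complex.I * betaMode α k j * h)) * h1 -
    (4 * Real.pi * up j * betaMode α k j) * hE + (4 * Real.pi * up j * betaMode α k j *
      (Complex.exp (Complex.I * betaMode α k j * h) *
      Complex.exp (-Complex.I * betaMode α k j * h))) * Complex.I_sq

/-- The case `b = -β_j` of `rayleigh_balance`, with the roles of the two layers exchanged. -/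
theorem rayleigh_coeff_minus {α k h : ℝ} {n uin usc : Plane → ℂ} {up um : ℤ → ℂ} (hn : IsMedium n h)
    (huin : LocallyIntegrable uin) (hq : IsQuasiperiodic α uin)
    (hs : IsScatteredField α k h n uin usc up um) {j : ℤ} (hj : j ∈ propagating α k)
    (hβ : betaMode α k j ≠ 0) :
    um j = k ^ 2 * ∫ y in scatterer n, greenCoeffMinus α k h j y * contrast n y * (uin y + usc y) := by
  have h1 := rayleigh_balance hn huin hq hs j (b := -betaMode α k j)
    (by rw [neg_sq]; exact propagating_sq_add hj)
  have h2 := integral_smoothStep_mul_exp (2 * (-Complex.I * -betaMode α k j))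
  have h3 := integral_deriv_deriv_smoothStep_add (2 * (-Complex.I * -betaMode α k j))
  rw [show Complex.I * (betaMode α k j - -betaMode α k j) = 2 * (-Complex.I * -betaMode α k j) by ring,
    h2] at h1
  simp only [add_neg_cancel, mul_zero, zero_mul, Complex.exp_zero, mul_one, h3, sub_zero] at h1
  have hpi : (Real.pi : ℂ) ≠ 0 := by exact_mod_cast Real.pi_ne_zero
  have hg : ∀ y : Plane, greenCoeffMinus α k h j y * contrast n y * (uin y + usc y)
      = (Complex.I / (4 * Real.pi * betaMode α k j) * Complex.exp (Complex.I * betaMode α k j * h)) *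
        (Complex.exp (-Complex.I * alphaMode α j * y 0 - Complex.I * -betaMode α k j * y 1) *
          contrast n y * (uin y + usc y)) := by
    intro y
    rw [greenCoeffMinus, show -Complex.I * alphaMode α j * y 0 + Complex.I * betaMode α k j * (y 1 + h)
      = Complex.I * betaMode α k j * h +
        (-Complex.I * alphaMode α j * y 0 - Complex.I * -betaMode α k j * y 1) by ring,
      Complex.exp_add]
    ring
  simp_rw [hg]
  rw [integral_const_mul]
  have hE : Complex.exp (Complex.I * betaMode α k j * h) *
      Complex.exp (Complex.I * betaMode α k j + Complex.I * -betaMode α k j * (h + 1)) = 1 := by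
    rw [← Complex.exp_add, Complex.exp_eq_one_iff]
    exact ⟨0, by push_cast; ring⟩
  rw [div_mul_eq_mul_div, div_mul_eq_mul_div, mul_div_assoc', eq_div_iff (by simp [hpi, hβ])]
  linear_combination (-Complex.I * Complex.exp (Complex.I * betaMode α k j * h)) * h1 -
    (4 * Real.pi * um j * betaMode α k j) * hE + (4 * Real.pi * um j * betaMode α k j *
      (Complex.exp (Complex.I * betaMode α k j * h) *
      Complex.exp (Complex.I * betaMode α k j + Complex.I * -betaMode α k j * (h + 1)))) * Complex.I_sq

theorem continuous_greenCoeffPlus (α k h : ℝ) (j : ℤ) : Continuous (greenCoeffPlus α k h j) := by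
  unfold greenCoeffPlus; fun_prop

theorem continuous_greenCoeffMinus (α k h : ℝ) (j : ℤ) : Continuous (greenCoeffMinus α k h j) := by
  unfold greenCoeffMinus; fun_prop

/-- The contribution of one propagating mode: the phases depending on `h` cancel, and the upward and
the downward wave add up to a cosine. -/
theorem greenCoeff_mul_conj {α k : ℝ} (h : ℝ) {j : ℤ} (hj : j ∈ propagating α k) (z y : Plane) :
    betaMode α k j * (greenCoeffPlus α k h j y * conj (greenCoeffPlus α k h j z) +
        greenCoeffMinus α k h j y * conj (greenCoeffMinus α k h j z))
      = 1 / (8 * Real.pi) *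
        ((Real.pi : ℂ)⁻¹ * waveDensity k (z 0 - y 0) (z 1 - y 1) (alphaMode α j)) := by
  have hpos : 0 < Real.sqrt (k ^ 2 - alphaMode α j ^ 2) :=
    Real.sqrt_pos.2 (sub_pos.2 (mem_propagating_iff.1 hj))
  simp only [greenCoeffPlus, greenCoeffMinus, betaMode_of_propagating hj, waveDensity]
  generalize Real.sqrt (k ^ 2 - alphaMode α j ^ 2) = β at hpos
  generalize alphaMode α j = a
  have hβ : (β : ℂ) ≠ 0 := by exact_mod_cast hpos.ne'
  have hpi : (Real.pi : ℂ) ≠ 0 := by exact_mod_cast Real.pi_ne_zero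
  simp only [map_mul, map_div₀, ← Complex.exp_conj, map_sub, map_add, map_neg, Complex.conj_I,
    Complex.conj_ofReal, map_ofNat]
  have e1 : Complex.exp (-Complex.I * a * y 0 - Complex.I * β * (y 1 - h)) *
      Complex.exp (- -Complex.I * a * z 0 - -Complex.I * β * (z 1 - h))
      = Complex.exp (Complex.I * (a * (z 0 - y 0) : ℝ)) *
        Complex.exp ((β * (z 1 - y 1) : ℝ) * Complex.I) := by
    rw [← Complex.exp_add, ← Complex.exp_add]; congr 1; push_cast; ring
  have e2 : Complex.exp (-Complex.I * a * y 0 + Complex.I * β * (y 1 + h)) *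
      Complex.exp (- -Complex.I * a * z 0 + -Complex.I * β * (z 1 + h))
      = Complex.exp (Complex.I * (a * (z 0 - y 0) : ℝ)) *
        Complex.exp (-((β * (z 1 - y 1) : ℝ) : ℂ) * Complex.I) := by
    rw [← Complex.exp_add, ← Complex.exp_add]; congr 1; push_cast; ring
  rw [Complex.ofReal_div, Complex.ofReal_cos, Complex.cos]
  calc _ = (-(Complex.I ^ 2)) / (16 * Real.pi ^ 2 * β) *
        (Complex.exp (-Complex.I * a * y 0 - Complex.I * β * (y 1 - h)) *
          Complex.exp (- -Complex.I * a * z 0 - -Complex.I * β * (z 1 - h)) +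
        Complex.exp (-Complex.I * a * y 0 + Complex.I * β * (y 1 + h)) *
          Complex.exp (- -Complex.I * a * z 0 + -Complex.I * β * (z 1 + h))) := by
        field_simp
        ring
    _ = _ := by
        rw [e1, e2, Complex.I_sq]
        field_simp
        ring

theorem continuous_kernel {α k : ℝ} (hk : 0 < k) (hβ : ∀ j : ℤ, betaMode α k j ≠ 0) (z : Plane) :
    Continuous fun y => (besselJ0 (k * ‖z - y‖) : ℂ) + latticeSum α k z y := by
  simp_rw [besselJ0_add_latticeSum hk hβ]
  unfold waveDensity
  fun_prop

/-- For one scattered field, the sum inside the indicator function is the integral of the source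
against the kernel `J₀(k|z - y|) + w_α(z, y)`. -/
theorem sum_propagating_eq_integral {α k h : ℝ} (hk : 0 < k) (hβ : ∀ j : ℤ, betaMode α k j ≠ 0)
    {n uin usc : Plane → ℂ} {up um : ℤ → ℂ} (hn : IsMedium n h)
    (huin : LocallyIntegrable uin) (hq : IsQuasiperiodic α uin)
    (hs : IsScatteredField α k h n uin usc up um) (z : Plane) :
    ∑ j ∈ (propagating_finite α k).toFinset, betaMode α k j *
        (up j * conj (greenCoeffPlus α k h j z) + um j * conj (greenCoeffMinus α k h j z))
      = ((k ^ 2 / (8 * Real.pi) : ℝ) : ℂ) * ∫ y in scatterer n,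
          ((besselJ0 (k * ‖z - y‖) : ℂ) + latticeSum α k z y) * contrast n y *
            (uin y + usc y) := by
  have hu : LocallyIntegrable fun x => uin x + usc x := huin.add hs.locallyIntegrable
  have hterm : ∀ j ∈ (propagating_finite α k).toFinset, betaMode α k j *
        (up j * conj (greenCoeffPlus α k h j z) + um j * conj (greenCoeffMinus α k h j z))
      = ∫ y in scatterer n, ((k ^ 2 / (8 * Real.pi) : ℝ) : ℂ) *
        (((Real.pi : ℂ)⁻¹ * waveDensity k (z 0 - y 0) (z 1 - y 1) (alphaMode α j)) *
          contrast n y * (uin y + usc y)) := by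
    intro j hj
    have hj' := (Set.Finite.mem_toFinset _).1 hj
    rw [rayleigh_coeff_plus hn huin hq hs hj' (hβ j), rayleigh_coeff_minus hn huin hq hs hj' (hβ j)]
    have i1 := integrableOn_scatterer hn hu (continuous_greenCoeffPlus α k h j)
    have i2 := integrableOn_scatterer hn hu (continuous_greenCoeffMinus α k h j)
    rw [mul_right_comm, mul_right_comm ((k : ℂ) ^ 2) _ (conj (greenCoeffMinus α k h j z)),
      ← integral_const_mul, ← integral_const_mul, ← integral_add (i1.const_mul _) (i2.const_mul _),
      ← integral_const_mul]
    refine integral_congr_ae (Filter.Eventually.of_forall fun y => ?_)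
    simp only
    have := greenCoeff_mul_conj h hj' z y
    push_cast
    linear_combination (k ^ 2 * contrast n y * (uin y + usc y)) * this
  rw [Finset.sum_congr rfl hterm, ← integral_finsetSum, ← integral_const_mul]
  · refine integral_congr_ae (Filter.Eventually.of_forall fun y => ?_)
    simp only [besselJ0_add_latticeSum hk hβ, ← Finset.mul_sum, ← Finset.sum_mul]
  · intro j _
    refine (integrableOn_scatterer hn hu ?_).const_mul _
    unfold waveDensity
    fun_prop

end PeriodicScattering

end

theorem theorem1 (α k h : ℝ) (hk : 0 < k)
    (hβ : ∀ j : ℤ, PeriodicScattering.betaMode α k j ≠ 0)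
    (n : PeriodicScattering.Plane → ℂ) (hn : PeriodicScattering.IsMedium n h)
    (N p : ℕ)
    (uin usc : Fin N → PeriodicScattering.Plane → ℂ)
    (up um : Fin N → ℤ → ℂ)
    (huin : ∀ l, LocallyIntegrable (uin l))
    (huin_quasi : ∀ l, PeriodicScattering.IsQuasiperiodic α (uin l))
    (husc : ∀ l, PeriodicScattering.IsScatteredField α k h n (uin l) (usc l) (up l) (um l)) :
    (∀ z ∈ PeriodicScattering.cell, ∀ y ∈ PeriodicScattering.cell,
      Summable (PeriodicScattering.latticeTerm α k z y) (SummationFilter.conditional ℤ)) ∧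
    ∀ z ∈ PeriodicScattering.cell,
      (∀ l, IntegrableOn
        (fun y => ((PeriodicScattering.besselJ0 (k * ‖z - y‖) : ℂ)
            + PeriodicScattering.latticeSum α k z y)
          * PeriodicScattering.contrast n y * (uin l y + usc l y))
        (PeriodicScattering.scatterer n)) ∧
      PeriodicScattering.indicator α k h p up um z =
        (k ^ 2 / (8 * Real.pi)) ^ p *
          ∑ l, ‖∫ y in PeriodicScattering.scatterer n,
            ((PeriodicScattering.besselJ0 (k * ‖z - y‖) : ℂ)
              + PeriodicScattering.latticeSum α k z y)
            * PeriodicScattering.contrast n y * (uin l y + usc l y)‖ ^ p := by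
  refine ⟨fun z _ y _ => (PeriodicScattering.hasSum_latticeTerm hk hβ z y).summable,
    fun z _ => ⟨fun l => ?_, ?_⟩⟩
  · exact PeriodicScattering.integrableOn_scatterer hn ((huin l).add (husc l).locallyIntegrable)
      (PeriodicScattering.continuous_kernel hk hβ z)
  · have hc : 0 ≤ k ^ 2 / (8 * Real.pi) := by positivity
    simp only [PeriodicScattering.indicator, PeriodicScattering.sum_propagating_eq_integral hk hβ hn
      (huin _) (huin_quasi _) (husc _) z, norm_mul, mul_pow, ← Finset.mul_sum, Complex.norm_real,
      Real.norm_of_nonneg hc]
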